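/- Proposition 4.5 (prop:MpIsNat). Let $(E,\omega,J)$ be a (finite-dimensional) Kähler vector space of complex dimension $N$, with inner product $g(u,v)=\omega(u,Jv)$ and norm $\|v\|^2=g(v,v)$. Let $\mathcal B(E)$ be its Bargmann space, consisting of the functions $\psi(v)=f(v)e^{-\|v\|^2/2}$ with $f:E\to\mathbb C$ holomorphic with respect to $J$ and $\psi\in L^2(E)$, and let $\mathcal B^\infty(E)\subset\mathcal B(E)$ be the space of smooth vectors, i.e. of those $\psi\in\mathcal B(E)$ such that $a\mapsto\langle\rho(a)\psi,\chi\rangle$ is smooth on $E$ for every $\chi\in\mathcal B(E)$, where $(\rho(a)\psi)(v)=e^{i\omega(a,v)}\psi(v-a)$. For a linear symplectic isomorphism $\Phi$ of $E$ let $$\mathcal W(\Phi)=\eta_{J,\Phi}\,P_E\circ U_\Phi:\mathcal B(E)\to\mathcal B(E),\qquad \eta_{J,\Phi}=2^{-N}\big(\det[(I-iJ)+\Phi(I+iJ)]\big)^{1/2},$$ where $U_\Phi\psi=\psi\circ\Phi^{-1}$, $P_E$ is the orthogonal projector of $L^2(E)$ onto $\mathcal B(E)$, the determinant is taken over $\mathbb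 C$ on $E\otimes\mathbb C$, and the square root is the principal one. Let $\mathcal C\subset E$ be a coisotropic subspace, that is, $\mathcal C^\circ\subset\mathcal C$, where $^\circ$ denotes the symplectic annihilator, and let $\mathcal H=\mathcal C\cap J(\mathcal C)$ be its maximal complex subspace. The reduction $F=\mathcal C/\mathcal C^\circ$ is a Kähler vector space through the identification $\mathcal H\cong F$ given by the projection $v\mapsto[v]$. For $\psi\in\mathcal B^\infty(E)$ put $$(R\psi)([v])=\int_{\mathcal C^\circ}\psi(v+y)\,dy,\qquad v\in\mathcal C,$$ where $dy$ is the measure on $\mathcal C^\circ$ induced by $g$. Let $\Phi:E\to E$ be a linear symplectic isomorphism such that 1. $\Phi(\mathcal C)=\mathcal C$, and 2. $\Phi(v)=v$ for all $v\in\mathcal H^\circ$, and let $\phi:F\to F$, $\phi([v])=[\Phi(v)]$, be the reduced symplectic map. Then these integrals converge absolutely and $R$ maps $\mathcal B^\infty(E)$ into $\mathcal B^\infty(F)$, the operator $\mathcal W(\Phi)$ maps $\mathcal B^\infty(E)$ into itself, and $$R\circ\mathcal W(\Phi)=\mathcal W(\phi)\circ R\qquad\text{on }\mathcal B^\infty(E).$$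 -/

import Mathlib

open MeasureTheory
open scoped ComplexConjugate TensorProduct

noncomputable section

set_option linter.unusedSectionVars false

namespace BargmannReduction

/-- A Kähler vector space: a real vector space with a symplectic form `ω` and a complex
structure `J` such that `g(u,v) = ω(u, J v)` is a positive definite inner product.  The inner
product `g` is the one carried by the `InnerProductSpace` structure, so that `‖v‖² = g(v,v)`. -/
class KahlerSpace (E : Type*) [NormedAddCommGroup E] [InnerProductSpace ℝ E] where
  /-- the complex structure -/
  J : E →ₗ[ℝ] E
  /-- the symplectic form -/
  symp : LinearMap.BilinForm ℝ E
  J_J : ∀ v, J (J v) = -v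
  symp_self : ∀ v, symp v v = 0
  inner_eq : ∀ u v, inner ℝ u v = symp u (J v)

open KahlerSpace

section Basic

variable {E : Type*} [NormedAddCommGroup E] [InnerProductSpace ℝ E] [KahlerSpace E]

theorem symp_swap (u v : E) : symp u v = - symp v u := by
  have h := symp_self (u + v)
  simp only [map_add, LinearMap.add_apply, symp_self] at h
  linarith

theorem inner_J_left (u v : E) : inner ℝ (J u) v = symp u v := by
  rw [real_inner_comm, inner_eq, J_J, map_neg, symp_swap u v]

theorem inner_J_right (u v : E) : inner ℝ u (J v) = - symp u v := by
  rw [inner_eq, J_J, map_neg]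

theorem inner_J_J (u v : E) : inner ℝ (J u) (J v) = inner ℝ u v := by
  rw [inner_J_left, inner_eq]

theorem symp_J_J (u v : E) : symp (J u) (J v) = symp u v := by
  rw [← inner_eq, inner_J_left]

theorem norm_J (v : E) : ‖J v‖ = ‖v‖ := by
  rw [@norm_eq_sqrt_real_inner E, @norm_eq_sqrt_real_inner E, inner_J_J]

/-- The symplectic annihilator `S° = {v | ω(u,v) = 0 for all u ∈ S}`. -/
def sympAnn (S : Submodule ℝ E) : Submodule ℝ E := S.orthogonalBilin symp

theorem mem_sympAnn {S : Submodule ℝ E} {v : E} : v ∈ sympAnn S ↔ ∀ u ∈ S, symp u v = 0 :=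
  Iff.rfl

/-- `C` is coisotropic: `C° ⊆ C`. -/
class IsCoisotropic (C : Submodule ℝ E) : Prop where
  ann_le : sympAnn C ≤ C

/-- The maximal complex subspace `H = C ∩ J(C)`. -/
def maxComplex (C : Submodule ℝ E) : Submodule ℝ E := C ⊓ C.map J

/-- The group `Sp(E)` of linear symplectic isomorphisms. -/
def Sp (E : Type*) [NormedAddCommGroup E] [InnerProductSpace ℝ E] [KahlerSpace E] :
    Subgroup (E ≃ₗ[ℝ] E) where
  carrier := {Φ | ∀ u v, symp (Φ u) (Φ v) = symp u v}
  mul_mem' := fun {a b} ha hb u v => (ha (b u) (b v)).trans (hb u v)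
  one_mem' := fun _ _ => rfl
  inv_mem' := fun {a} ha u v => by
    have h := ha (a.symm u) (a.symm v)
    simp only [LinearEquiv.apply_symm_apply] at h
    exact h.symm

end Basic

/-! ### Bargmann space -/

section Bargmann

variable {E : Type*} [NormedAddCommGroup E] [InnerProductSpace ℝ E] [KahlerSpace E]

/-- Solutions of `∂̄ f = 0` with respect to the complex structure `J`. -/
def IsHolomorphic (f : E → ℂ) : Prop :=
  Differentiable ℝ f ∧ ∀ v u, fderiv ℝ f v (J u) = Complex.I * fderiv ℝ f v u

/-- The Heisenberg operators `(ρ(a)ψ)(v) = exp(i ω(a,v)) ψ(v - a)`. -/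
def heis (a : E) (ψ : E → ℂ) : E → ℂ :=
  fun v => Complex.exp (Complex.I * (symp a v : ℝ)) * ψ (v - a)

variable [FiniteDimensional ℝ E] [MeasurableSpace E] [BorelSpace E]

variable (E) in
/-- The Bargmann space `B(E)`: the functions `ψ(v) = f(v) exp(-‖v‖²/2)` with `f` holomorphic and
`ψ` square integrable (with respect to the Lebesgue measure of the inner product `g`). -/
def bargmann : Submodule ℂ (E → ℂ) where
  carrier := {ψ | (∃ f : E → ℂ, IsHolomorphic f ∧
      ∀ v, ψ v = f v * (Real.exp (-‖v‖ ^ 2 / 2) : ℝ)) ∧ MemLp ψ 2 (volume : Measure E)}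
  zero_mem' := ⟨⟨fun _ => 0, ⟨differentiable_const 0, by simp⟩, by simp⟩, MemLp.zero⟩
  add_mem' := by
    rintro ψ₁ ψ₂ ⟨⟨f₁, h₁, e₁⟩, m₁⟩ ⟨⟨f₂, h₂, e₂⟩, m₂⟩
    refine ⟨⟨f₁ + f₂, ⟨h₁.1.add h₂.1, fun v u => ?_⟩, fun v => ?_⟩, m₁.add m₂⟩
    · rw [fderiv_add (h₁.1 v) (h₂.1 v)]
      simp only [add_apply, h₁.2, h₂.2, mul_add]
    · simp only [Pi.add_apply, e₁, e₂, add_mul]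
  smul_mem' := by
    rintro c ψ ⟨⟨f, h, e⟩, m⟩
    refine ⟨⟨c • f, ⟨h.1.const_smul c, fun v u => ?_⟩, fun v => ?_⟩, m.const_smul c⟩
    · rw [fderiv_const_smul (h.1 v)]
      simp only [smul_apply, h.2, smul_eq_mul]
      ring
    · simp only [Pi.smul_apply, e, smul_eq_mul, mul_assoc]

variable (E) in
/-- The smooth vectors `B^∞(E)` of the Heisenberg representation: those `ψ ∈ B(E)` for which
`a ↦ ⟨ρ(a)ψ, φ⟩` is smooth for all `φ ∈ B(E)`. -/
def smoothVectors : Set (E → ℂ) :=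
  {ψ | ψ ∈ bargmann E ∧ ∀ φ ∈ bargmann E,
    ContDiff ℝ ((⊤ : ℕ∞) : WithTop ℕ∞) fun a : E => ∫ v, heis a ψ v * conj (φ v)}

/-! The Bargmann space is closed in `L²`, so that the orthogonal projector onto it exists. -/

/-- `v ↦ cos θ v + sin θ J v` -/
def rot (θ : ℝ) : E ≃ₗᵢ[ℝ] E :=
  LinearIsometry.toLinearIsometryEquiv
    { toLinearMap := Real.cos θ • LinearMap.id + Real.sin θ • J
      norm_map' := fun v => by
        have h : ‖Real.cos θ • v + Real.sin θ • J v‖ ^ 2 = ‖v‖ ^ 2 := by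
          rw [@norm_add_sq_real E, norm_smul, norm_smul, norm_J, inner_smul_left, inner_smul_right,
            inner_J_right, symp_self]
          simp only [Real.norm_eq_abs, mul_pow, sq_abs]
          simp only [neg_zero, mul_zero, add_zero]
          rw [← add_mul, Real.cos_sq_add_sin_sq, one_mul]
        exact (pow_left_inj₀ (norm_nonneg _) (norm_nonneg _) two_ne_zero).1 h } rfl

theorem rot_apply (θ : ℝ) (v : E) : rot θ v = Real.cos θ • v + Real.sin θ • J v := rfl


theorem differentiable_slice {f : E → ℂ} (hf : IsHolomorphic f) (v : E) :
    Differentiable ℂ fun z : ℂ => f (z.re • v + z.im • J v) := by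
  intro z
  have hL : ∀ z : ℂ, HasFDerivAt (fun z : ℂ => f (z.re • v + z.im • J v))
      ((fderiv ℝ f (z.re • v + z.im • J v)).comp
        (Complex.reCLM.smulRight v + Complex.imCLM.smulRight (J v))) z := fun z =>
    ((hf.1 _).hasFDerivAt).comp z
      (f := fun z : ℂ => z.re • v + z.im • J v)
      ((Complex.reCLM.smulRight v + Complex.imCLM.smulRight (J v)).hasFDerivAt)
  refine differentiableAt_complex_iff_differentiableAt_real.2 ⟨(hL z).differentiableAt, ?_⟩
  rw [(hL z).fderiv]
  simp [hf.2]

theorem circle_mean {f : E → ℂ} (hf : IsHolomorphic f) (v : E) :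
    ∫ θ in (0 : ℝ)..2 * Real.pi, f (rot θ v) = (2 * Real.pi) * f 0 := by
  have h := ((differentiable_slice hf v).diffContOnCl (s := Metric.ball 0 |1|)).circleAverage
  rw [Real.circleAverage_def] at h
  simp only [Complex.zero_re, Complex.zero_im, zero_smul, add_zero] at h
  rw [← h]
  have e : ∀ θ : ℝ, f (rot θ v) = f ((circleMap 0 1 θ).re • v + (circleMap 0 1 θ).im • J v) := by
    intro θ
    simp [rot_apply, circleMap, Complex.exp_ofReal_mul_I_re, Complex.exp_ofReal_mul_I_im]
  simp only [e]
  have : (2 * Real.pi : ℝ) ≠ 0 := by positivity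
  rw [Complex.real_smul]
  push_cast
  rw [← mul_assoc, mul_inv_cancel₀ (by exact_mod_cast this), one_mul]

theorem integrable_gauss {b : ℝ} (hb : 0 < b) :
    Integrable (fun v : E => Real.exp (-b * ‖v‖ ^ 2)) := by
  have h := (GaussianFourier.integrable_cexp_neg_mul_sq_norm_add (V := E) (b := b)
    (by simpa using hb) 0 0).re
  refine h.congr (Filter.Eventually.of_forall fun v => ?_)
  simp only [zero_mul, add_zero]
  rw [show (-(b : ℂ) * (‖v‖ : ℂ) ^ 2) = ((-b * ‖v‖ ^ 2 : ℝ) : ℂ) by push_cast; ring]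
  exact Complex.exp_ofReal_re _

theorem memLp_gauss {b : ℝ} (hb : 0 < b) :
    MemLp (fun v : E => ((Real.exp (-b * ‖v‖ ^ 2) : ℝ) : ℂ)) 2 (volume : Measure E) := by
  have hc : Continuous fun v : E => ((Real.exp (-b * ‖v‖ ^ 2) : ℝ) : ℂ) := by fun_prop
  rw [memLp_two_iff_integrable_sq_norm hc.aestronglyMeasurable]
  refine (integrable_gauss (E := E) (b := 2 * b) (by positivity)).congr
    (Filter.Eventually.of_forall fun v => ?_)
  simp only [Complex.norm_real, Real.norm_eq_abs, sq_abs]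
  rw [← Real.exp_nat_mul]
  congr 1; push_cast; ring

theorem gauss_mean {f : E → ℂ} (hf : IsHolomorphic f)
    (hi : Integrable fun v : E => f v * (Real.exp (-‖v‖ ^ 2) : ℝ)) :
    ∫ v, f v * (Real.exp (-‖v‖ ^ 2) : ℝ) = (∫ v : E, (Real.exp (-‖v‖ ^ 2) : ℝ)) * f 0 := by
  have hfc : Continuous f := hf.1.continuous
  set G : E → ℂ := fun v => f v * (Real.exp (-‖v‖ ^ 2) : ℝ) with hG
  have hrot : ∀ θ v, G (rot θ v) = f (rot θ v) * (Real.exp (-‖v‖ ^ 2) : ℝ) := fun θ v => by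
    simp only [hG, LinearIsometryEquiv.norm_map]
  have hmp : ∀ θ : ℝ, MeasurePreserving (rot (E := E) θ) := fun θ =>
    LinearIsometryEquiv.measurePreserving _
  have hemb : ∀ θ : ℝ, MeasurableEmbedding (rot (E := E) θ) := fun θ =>
    (rot θ).toHomeomorph.measurableEmbedding
  have hconst : ∀ θ : ℝ, ∫ v, G (rot θ v) = ∫ v, G v := fun θ =>
    (hmp θ).integral_comp (hemb θ) G
  have hcont : Continuous fun p : ℝ × E => G (rot p.1 p.2) := by
    have hJ : Continuous (J : E →ₗ[ℝ] E) := LinearMap.continuous_of_finiteDimensional _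
    simp only [hG, rot_apply]
    fun_prop
  have hpi : (2 * Real.pi : ℂ) ≠ 0 := by exact_mod_cast (by positivity : (2 * Real.pi : ℝ) ≠ 0)
  have hint : Integrable (Function.uncurry fun (θ : ℝ) (v : E) => G (rot θ v))
      ((volume.restrict (Set.uIoc 0 (2 * Real.pi))).prod volume) := by
    refine (integrable_prod_iff (f := Function.uncurry fun (θ : ℝ) (v : E) => G (rot θ v))
      hcont.aestronglyMeasurable).2 ⟨Filter.Eventually.of_forall fun θ => ?_, ?_⟩
    · exact ((hmp θ).integrable_comp_emb (hemb θ)).2 hi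
    · have : ∀ θ : ℝ, ∫ v, ‖G (rot θ v)‖ = ∫ v, ‖G v‖ := fun θ =>
        (hmp θ).integral_comp (hemb θ) fun v => ‖G v‖
      simp only [Function.uncurry, this]
      have : IsFiniteMeasure ((volume : Measure ℝ).restrict (Set.uIoc 0 (2 * Real.pi))) := by
        rw [Set.uIoc]; infer_instance
      exact integrable_const _
  have h1 : ∫ θ in (0 : ℝ)..2 * Real.pi, ∫ v, G (rot θ v) = (2 * Real.pi) * ∫ v, G v := by
    simp only [hconst]
    rw [intervalIntegral.integral_const, Complex.real_smul]
    push_cast; ring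
  have h2 : ∫ θ in (0 : ℝ)..2 * Real.pi, ∫ v, G (rot θ v)
      = ∫ v, ∫ θ in (0 : ℝ)..2 * Real.pi, G (rot θ v) :=
    intervalIntegral_integral_swap hint
  have h3 : ∀ v, ∫ θ in (0 : ℝ)..2 * Real.pi, G (rot θ v)
      = (2 * Real.pi) * ((Real.exp (-‖v‖ ^ 2) : ℝ) * f 0) := fun v => by
    simp only [hrot]
    rw [intervalIntegral.integral_mul_const, circle_mean hf]
    ring
  rw [h2] at h1
  simp only [h3] at h1
  rw [integral_const_mul] at h1
  rw [← mul_left_cancel₀ hpi h1, integral_mul_const, integral_complex_ofReal]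

/-- The real-linear functional `w ↦ g(v,w) + i ω(v,w)`; it is holomorphic in `w`. -/
def kexp (v : E) : E →L[ℝ] ℂ :=
  LinearMap.toContinuousLinearMap
    (Complex.ofRealCLM.toLinearMap ∘ₗ (innerₗ E v)
      + Complex.I • (Complex.ofRealCLM.toLinearMap ∘ₗ (symp v)))

theorem kexp_apply (v w : E) :
    kexp v w = ((inner ℝ v w : ℝ) : ℂ) + Complex.I * ((symp v w : ℝ) : ℂ) := by
  simp [kexp]

theorem kexp_J (v w : E) : kexp v (J w) = Complex.I * kexp v w := by
  rw [kexp_apply, kexp_apply, inner_J_right, ← inner_eq, mul_add, ← mul_assoc, Complex.I_mul_I]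
  push_cast; ring

theorem kexp_re (v w : E) : (kexp v w).re = inner ℝ v w := by
  rw [kexp_apply]; simp

theorem norm_cexp_kexp (v w : E) : ‖Complex.exp (kexp v w)‖ = Real.exp (inner ℝ v w) := by
  rw [Complex.norm_exp, kexp_re]

theorem exp_inner_le (v w : E) :
    Real.exp (inner ℝ v w) ≤ Real.exp (‖w‖ ^ 2) * Real.exp (‖v‖ ^ 2 / 4) := by
  rw [← Real.exp_add]
  refine Real.exp_le_exp.2 ((real_inner_le_norm v w).trans ?_)
  nlinarith [sq_nonneg (‖w‖ - ‖v‖ / 2)]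

/-- The (unnormalized, conjugated) reproducing kernel. -/
def kern (w v : E) : ℂ := ((Real.exp (-‖v‖ ^ 2 / 2) : ℝ) : ℂ) * Complex.exp (kexp v w)

theorem continuous_kern (w : E) : Continuous (kern w) := by
  have h : Continuous fun v : E => symp v w :=
    LinearMap.continuous_of_finiteDimensional ((LinearMap.flip symp) w)
  unfold kern
  simp only [kexp_apply]
  fun_prop

theorem norm_kern_le (w v : E) :
    ‖kern w v‖ ≤ Real.exp (‖w‖ ^ 2) * Real.exp (-(1 / 4) * ‖v‖ ^ 2) := by
  rw [kern, norm_mul, norm_cexp_kexp, Complex.norm_real, Real.norm_eq_abs, Real.abs_exp]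
  refine (mul_le_mul_of_nonneg_left (exp_inner_le v w) (Real.exp_pos _).le).trans (le_of_eq ?_)
  rw [← Real.exp_add, ← Real.exp_add, ← Real.exp_add]
  congr 1; ring

theorem memLp_kern (w : E) : MemLp (kern w) 2 (volume : Measure E) := by
  refine ((memLp_gauss (E := E) (b := 1 / 4) (by norm_num)).const_mul
    ((Real.exp (‖w‖ ^ 2) : ℝ) : ℂ)).of_le (continuous_kern w).aestronglyMeasurable
    (Filter.Eventually.of_forall fun v => (norm_kern_le w v).trans (le_of_eq ?_))
  rw [norm_mul, Complex.norm_real, Complex.norm_real, Real.norm_eq_abs, Real.norm_eq_abs,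
    Real.abs_exp, Real.abs_exp]

/-- The integral transform with kernel `kern`. -/
def kernInt (u : E → ℂ) (w : E) : ℂ := ∫ v, u v * kern w v

theorem reproducing {f : E → ℂ} (hf : IsHolomorphic f)
    (hm : MemLp (fun v => f v * (Real.exp (-‖v‖ ^ 2 / 2) : ℝ)) 2 (volume : Measure E)) (w : E) :
    kernInt (fun v => f v * (Real.exp (-‖v‖ ^ 2 / 2) : ℝ)) w
      = (∫ v : E, (Real.exp (-‖v‖ ^ 2) : ℝ)) * f w := by
  set h : E → ℂ := fun v => f (v + w) * Complex.exp (-kexp w v) with hh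
  have hd : ∀ v, HasFDerivAt h (f (v + w) • (Complex.exp (-kexp w v) • (-kexp w)) +
      Complex.exp (-kexp w v) • fderiv ℝ f (v + w)) v := by
    intro v
    have h1 : HasFDerivAt (fun v => f (v + w)) (fderiv ℝ f (v + w)) v :=
      (hasFDerivAt_comp_add_right w).2 (hf.1 _).hasFDerivAt
    have h2 : HasFDerivAt (fun v => Complex.exp (-kexp w v))
        (Complex.exp (-kexp w v) • (-kexp w)) v := ((kexp w).hasFDerivAt.neg).cexp
    exact h1.mul h2
  have hol : IsHolomorphic h := by
    refine ⟨fun v => (hd v).differentiableAt, fun v u => ?_⟩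
    rw [(hd v).fderiv]
    simp only [add_apply, smul_apply, neg_apply, smul_eq_mul, kexp_J, hf.2]
    ring
  have key : ∀ v, h (v - w) * (Real.exp (-‖v - w‖ ^ 2) : ℝ)
      = f v * (Real.exp (-‖v‖ ^ 2 / 2) : ℝ) * kern w v := by
    intro v
    have e : -kexp w (v - w) + ((-‖v - w‖ ^ 2 : ℝ) : ℂ)
        = ((-‖v‖ ^ 2 / 2 : ℝ) : ℂ) + (((-‖v‖ ^ 2 / 2 : ℝ) : ℂ) + kexp v w) := by
      rw [map_sub, kexp_apply, kexp_apply, kexp_apply, symp_self, symp_swap w v,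
        real_inner_self_eq_norm_sq, real_inner_comm, @norm_sub_sq_real E]
      push_cast; ring
    simp only [hh, kern, sub_add_cancel, Complex.ofReal_exp]
    rw [mul_assoc, mul_assoc, ← Complex.exp_add, ← Complex.exp_add, ← Complex.exp_add, e]
  have hint : Integrable fun v => f v * (Real.exp (-‖v‖ ^ 2 / 2) : ℝ) * kern w v :=
    hm.integrable_mul (memLp_kern w)
  have hint' : Integrable fun v => h v * (Real.exp (-‖v‖ ^ 2) : ℝ) := by
    simp only [← key] at hint
    simpa only [add_sub_cancel_right] using hint.comp_add_right w
  have := gauss_mean hol hint'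
  rw [← integral_sub_right_eq_self _ w] at this
  simp only [key] at this
  rw [kernInt, this]
  simp [hh]

theorem continuous_kexp : Continuous (kexp (E := E)) :=
  LinearMap.continuous_of_finiteDimensional
    ({ toFun := kexp
       map_add' := fun a b => by
         ext w; simp only [kexp_apply, add_apply, inner_add_left, map_add, LinearMap.add_apply]
         push_cast; ring
       map_smul' := fun r a => by
         ext w
         simp only [kexp_apply, smul_apply, inner_smul_left, map_smul, LinearMap.smul_apply,
           RingHom.id_apply, Complex.real_smul, conj_trivial, smul_eq_mul]
         push_cast; ring } : E →ₗ[ℝ] E →L[ℝ] ℂ)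

theorem norm_kexp_le (v : E) : ‖kexp v‖ ≤ 2 * ‖v‖ := by
  refine ContinuousLinearMap.opNorm_le_bound _ (by positivity) fun w => ?_
  rw [kexp_apply]
  refine (norm_add_le _ _).trans ?_
  rw [norm_mul, Complex.norm_I, Complex.norm_real, Complex.norm_real, ← inner_J_left]
  have h1 := norm_inner_le_norm (𝕜 := ℝ) v w
  have h2 := norm_inner_le_norm (𝕜 := ℝ) (J v) w
  rw [norm_J] at h2
  linarith

theorem holomorphic_kernInt {u : E → ℂ} (hu : MemLp u 2 (volume : Measure E)) :
    IsHolomorphic (kernInt u) := by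
  have hb : ∀ w v : E, ∀ w' ∈ Metric.ball w 1, ‖(u v * kern w' v) • kexp v‖
      ≤ ‖u v * ((8 * Real.exp ((‖w‖ + 1) ^ 2) : ℝ) *
        ((Real.exp (-(1 / 8) * ‖v‖ ^ 2) : ℝ) : ℂ))‖ := by
    intro w v w' hw'
    have hn : ‖w'‖ ≤ ‖w‖ + 1 := by
      have := norm_sub_norm_le w' w
      rw [mem_ball_iff_norm] at hw'
      linarith
    have h1 : ‖kern w' v‖ ≤ Real.exp ((‖w‖ + 1) ^ 2) * Real.exp (-(1 / 4) * ‖v‖ ^ 2) := by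
      refine (norm_kern_le w' v).trans (mul_le_mul_of_nonneg_right
        (Real.exp_le_exp.2 ?_) (Real.exp_pos _).le)
      gcongr
    have h2 : ‖kexp v‖ ≤ 8 * Real.exp (1 / 8 * ‖v‖ ^ 2) := by
      have h3 := Real.add_one_le_exp (1 / 8 * ‖v‖ ^ 2)
      have h4 := norm_kexp_le v
      nlinarith [sq_nonneg (‖v‖ - 1)]
    rw [norm_smul, norm_mul, norm_mul, norm_mul, Complex.norm_real, Complex.norm_real,
      Real.norm_of_nonneg (by positivity), Real.norm_of_nonneg (by positivity), mul_assoc]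
    refine mul_le_mul_of_nonneg_left ?_ (norm_nonneg _)
    refine (mul_le_mul h1 h2 (norm_nonneg _) (by positivity)).trans (le_of_eq ?_)
    have e : Real.exp (-(1 / 8) * ‖v‖ ^ 2)
        = Real.exp (-(1 / 4) * ‖v‖ ^ 2) * Real.exp (1 / 8 * ‖v‖ ^ 2) := by
      rw [← Real.exp_add]; congr 1; ring
    rw [e]; ring
  have hbi : ∀ w : E, Integrable fun v => u v * ((8 * Real.exp ((‖w‖ + 1) ^ 2) : ℝ) *
        ((Real.exp (-(1 / 8) * ‖v‖ ^ 2) : ℝ) : ℂ)) := fun w =>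
    hu.integrable_mul ((memLp_gauss (E := E) (b := 1 / 8) (by norm_num)).const_mul
      ((8 * Real.exp ((‖w‖ + 1) ^ 2) : ℝ) : ℂ))
  have hmeas : ∀ w : E, AEStronglyMeasurable (fun v => (u v * kern w v) • kexp v) volume :=
    fun w => (hu.1.mul (continuous_kern w).aestronglyMeasurable).smul
      continuous_kexp.aestronglyMeasurable
  have hd : ∀ w, HasFDerivAt (kernInt u) (∫ v, (u v * kern w v) • kexp v) w := by
    intro w
    refine hasFDerivAt_integral_of_dominated_of_fderiv_le (s := Metric.ball w 1)
      (F := fun w v => u v * kern w v) (F' := fun w v => (u v * kern w v) • kexp v)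
      (Metric.ball_mem_nhds w one_pos) ?_ ?_ (hmeas w)
      (Filter.Eventually.of_forall fun v w' hw' => hb w v w' hw') (hbi w).norm ?_
    · exact Filter.Eventually.of_forall fun w =>
        hu.1.mul (continuous_kern w).aestronglyMeasurable
    · exact hu.integrable_mul (memLp_kern w)
    · refine Filter.Eventually.of_forall fun v w _ => ?_
      have h := (((kexp v).hasFDerivAt (x := w)).cexp.const_mul
        ((Real.exp (-‖v‖ ^ 2 / 2) : ℝ) : ℂ)).const_mul (u v)
      refine h.congr_fderiv ?_
      simp only [smul_smul, kern]
  have hint : ∀ w, Integrable fun v => (u v * kern w v) • kexp v := fun w =>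
    (hbi w).norm.mono' (hmeas w)
      (Filter.Eventually.of_forall fun v => hb w v w (Metric.mem_ball_self one_pos))
  refine ⟨fun w => (hd w).differentiableAt, fun w x => ?_⟩
  rw [(hd w).fderiv, ContinuousLinearMap.integral_apply (hint w),
    ContinuousLinearMap.integral_apply (hint w), ← integral_const_mul]
  refine integral_congr_ae (Filter.Eventually.of_forall fun v => ?_)
  simp only [smul_apply, kexp_J, smul_eq_mul]
  ring

variable (E) in
/-- The Bargmann space as a subspace of `L²(E)`. -/
def bargmannL2 : Submodule ℂ (Lp ℂ 2 (volume : Measure E)) where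
  carrier := {u | ∃ ψ ∈ bargmann E, u =ᵐ[volume] ψ}
  zero_mem' := ⟨0, zero_mem _, Lp.coeFn_zero _ _ _⟩
  add_mem' := by
    rintro u₁ u₂ ⟨ψ₁, h₁, e₁⟩ ⟨ψ₂, h₂, e₂⟩
    exact ⟨ψ₁ + ψ₂, add_mem h₁ h₂, (Lp.coeFn_add _ _).trans (e₁.add e₂)⟩
  smul_mem' := by
    rintro c u ⟨ψ, h, e⟩
    exact ⟨c • ψ, Submodule.smul_mem _ c h, (Lp.coeFn_smul _ _).trans (e.const_smul c)⟩

variable (E) in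
/-- `∫ exp(-‖v‖²) dv`, the normalization of the reproducing kernel. -/
def gaussMass : ℝ := ∫ v : E, Real.exp (-‖v‖ ^ 2)

theorem gaussMass_pos : 0 < gaussMass E := by
  refine (integral_pos_iff_support_of_nonneg (fun v => (Real.exp_pos _).le) ?_).2 ?_
  · simpa using integrable_gauss (E := E) (b := 1) one_pos
  · have : Function.support (fun v : E => Real.exp (-‖v‖ ^ 2)) = Set.univ := by
      ext v; simp [(Real.exp_pos _).ne']
    rw [this]
    exact isOpen_univ.measure_pos volume Set.univ_nonempty

/-- The function representing the orthogonal projection. -/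
def kernProj (u : E → ℂ) (w : E) : ℂ :=
  ((gaussMass E : ℂ)⁻¹ * kernInt u w) * (Real.exp (-‖w‖ ^ 2 / 2) : ℝ)

theorem kernProj_of_mem {ψ : E → ℂ} (hψ : ψ ∈ bargmann E) : kernProj ψ = ψ := by
  obtain ⟨⟨f, hf, e⟩, m⟩ := hψ
  obtain rfl : ψ = fun v => f v * (Real.exp (-‖v‖ ^ 2 / 2) : ℝ) := funext e
  funext w
  have h0 : (gaussMass E : ℂ) ≠ 0 := by exact_mod_cast gaussMass_pos.ne'
  rw [kernProj, reproducing hf m w]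
  change ((gaussMass E : ℂ)⁻¹ * ((gaussMass E : ℂ) * f w)) * _ = _
  rw [inv_mul_cancel_left₀ h0]

theorem kernProj_congr {u u' : E → ℂ} (h : u =ᵐ[volume] u') : kernProj u = kernProj u' := by
  funext w
  unfold kernProj kernInt
  rw [integral_congr_ae (g := fun v => u' v * kern w v)]
  filter_upwards [h] with v hv
  rw [hv]

theorem mem_bargmannL2_iff (u : Lp ℂ 2 (volume : Measure E)) :
    u ∈ bargmannL2 E ↔ u =ᵐ[volume] kernProj u := by
  constructor
  · rintro ⟨ψ, h, e⟩
    rw [kernProj_congr e, kernProj_of_mem h]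
    exact e
  · intro e
    refine ⟨kernProj u, ⟨⟨_, ?_, fun v => rfl⟩, (memLp_congr_ae e).1 (Lp.memLp u)⟩, e⟩
    have h := holomorphic_kernInt (Lp.memLp u)
    refine ⟨h.1.const_mul _, fun v x => ?_⟩
    rw [fderiv_const_mul (h.1 v)]
    simp only [smul_apply, h.2, smul_eq_mul]
    ring

theorem tendsto_kernProj {u : ℕ → Lp ℂ 2 (volume : Measure E)} {u₀ : Lp ℂ 2 (volume : Measure E)}
    (h : Filter.Tendsto u Filter.atTop (nhds u₀)) (w : E) :
    Filter.Tendsto (fun n => kernProj (u n) w) Filter.atTop (nhds (kernProj u₀ w)) := by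
  have hk : MemLp (fun v => conj (kern w v)) 2 (volume : Measure E) := (memLp_kern w).star
  have e : ∀ u : Lp ℂ 2 (volume : Measure E), kernInt u w = inner ℂ hk.toLp u := by
    intro u
    rw [L2.inner_def, kernInt]
    refine integral_congr_ae ?_
    filter_upwards [hk.coeFn_toLp] with v hv
    rw [hv, RCLike.inner_apply, Complex.conj_conj]
  unfold kernProj
  simp only [e]
  exact ((Filter.Tendsto.inner tendsto_const_nhds h).const_mul _).mul_const _

variable (E) in
theorem isClosed_bargmannL2 : IsClosed (bargmannL2 E : Set (Lp ℂ 2 (volume : Measure E))) := by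
  rw [← isSeqClosed_iff_isClosed]
  intro u u₀ hu h
  have hu' : ∀ᵐ v, ∀ n, u n v = kernProj (u n) v :=
    ae_all_iff.2 fun n => (mem_bargmannL2_iff (u n)).1 (hu n)
  obtain ⟨ns, hns, hae⟩ := (tendstoInMeasure_of_tendsto_Lp h).exists_seq_tendsto_ae
  refine (mem_bargmannL2_iff u₀).2 ?_
  filter_upwards [hu', hae] with v h1 h2
  refine tendsto_nhds_unique h2 ?_
  simp only [h1]
  exact (tendsto_kernProj h v).comp hns.tendsto_atTop

instance : (bargmannL2 E).HasOrthogonalProjection :=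
  haveI : CompleteSpace (bargmannL2 E) := (isClosed_bargmannL2 E).completeSpace_coe
  inferInstance

/-- The orthogonal projector `P_E : L²(E) → B(E)`.  An element of `B(E)` is a function and not a
class modulo null sets, so the value is the representative that lies in `B(E)`, which is unique. -/
def bargmannProj (u : Lp ℂ 2 (volume : Measure E)) : E → ℂ :=
  ((bargmannL2 E).orthogonalProjectionOnto u).2.choose

theorem bargmannProj_mem (u : Lp ℂ 2 (volume : Measure E)) : bargmannProj u ∈ bargmann E :=
  ((bargmannL2 E).orthogonalProjectionOnto u).2.choose_spec.1

theorem bargmannProj_ae (u : Lp ℂ 2 (volume : Measure E)) :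
    (bargmannL2 E).starProjection u =ᵐ[volume] bargmannProj u :=
  ((bargmannL2 E).orthogonalProjectionOnto u).2.choose_spec.2

/-! ### The metaplectic operators -/

theorem memLp_comp_symm (Φ : E ≃ₗ[ℝ] E) {ψ : E → ℂ} (hψ : MemLp ψ 2 (volume : Measure E)) :
    MemLp (fun v => ψ (Φ.symm v)) 2 (volume : Measure E) := by
  have hc : Continuous Φ.symm := LinearMap.continuous_of_finiteDimensional Φ.symm.toLinearMap
  refine MemLp.comp_of_map (g := ψ) (f := Φ.symm) ?_ hc.aemeasurable
  have h := Measure.map_linearMap_addHaar_eq_smul_addHaar (volume : Measure E)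
    (f := Φ.symm.toLinearMap) (LinearEquiv.isUnit_det' Φ.symm).ne_zero
  rw [show (Φ.symm : E → E) = Φ.symm.toLinearMap from rfl, h]
  exact hψ.smul_measure ENNReal.ofReal_ne_top

/-- `U_Φ ψ = ψ ∘ Φ⁻¹`, for `ψ ∈ B(E) ⊆ L²(E)`, as an element of `L²(E)`. -/
def transportL2 (Φ : Sp E) (ψ : bargmann E) : Lp ℂ 2 (volume : Measure E) :=
  (memLp_comp_symm (Φ : E ≃ₗ[ℝ] E) ψ.2.2).toLp (fun v => (ψ : E → ℂ) ((Φ : E ≃ₗ[ℝ] E).symm v))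

/-- `η_{J,Φ} = 2^{-N} (det[(I - iJ) + Φ(I + iJ)])^{1/2}`, where `N` is the complex dimension of
`(E, J)`, the determinant is that of an endomorphism of the complexification of `E`, and the
square root is the principal one. -/
def metaplecticFactor (Φ : Sp E) : ℂ :=
  let Jc : Module.End ℂ (ℂ ⊗[ℝ] E) := LinearMap.baseChange ℂ (J : E →ₗ[ℝ] E)
  let Φc : Module.End ℂ (ℂ ⊗[ℝ] E) :=
    LinearMap.baseChange ℂ ((Φ : E ≃ₗ[ℝ] E) : E →ₗ[ℝ] E)
  ((2 : ℂ) ^ (Module.finrank ℝ E / 2))⁻¹ *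
    (LinearMap.det ((1 - Complex.I • Jc) + Φc * (1 + Complex.I • Jc))) ^ (1 / 2 : ℂ)

/-- The metaplectic operator `W(Φ) = η_{J,Φ} P_E ∘ U_Φ : B(E) → B(E)`. -/
def metaplectic (Φ : Sp E) (ψ : bargmann E) : bargmann E :=
  metaplecticFactor Φ • ⟨bargmannProj (transportL2 Φ ψ), bargmannProj_mem _⟩

end Bargmann

/-! ### Linear reduction -/

section Reduction

variable {E : Type*} [NormedAddCommGroup E] [InnerProductSpace ℝ E] [FiniteDimensional ℝ E]
  [KahlerSpace E]

theorem sympAnn_eq (C : Submodule ℝ E) : sympAnn C = (C.map J)ᗮ := by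
  ext v
  rw [mem_sympAnn, Submodule.mem_orthogonal]
  simp [inner_J_left]

theorem mem_of_symp_eq_zero {C : Submodule ℝ E} {w : E} (h : ∀ y ∈ sympAnn C, symp y w = 0) :
    w ∈ C := by
  have h1 : J w ∈ (C.map J)ᗮᗮ := by
    rw [Submodule.mem_orthogonal]
    intro y hy
    rw [inner_J_right, h y (by rwa [sympAnn_eq]), neg_zero]
  rw [Submodule.orthogonal_orthogonal] at h1
  obtain ⟨c, hc, e⟩ := h1
  have : c = w := by
    have := congrArg J e
    rwa [J_J, J_J, neg_inj] at this
  exact this ▸ hc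

theorem J_mem_maxComplex {C : Submodule ℝ E} {h : E} (hh : h ∈ maxComplex C) :
    J h ∈ maxComplex C := by
  obtain ⟨h1, c, hc, rfl⟩ := hh
  refine ⟨?_, _, h1, rfl⟩
  rw [J_J]
  exact C.neg_mem hc

variable (C : Submodule ℝ E)

/-- The reduction `F = C / C°` of a coisotropic subspace `C`. -/
def Reduction : Type _ := C ⧸ (sympAnn C).submoduleOf C

instance : AddCommGroup (Reduction C) :=
  inferInstanceAs (AddCommGroup (C ⧸ (sympAnn C).submoduleOf C))

instance : Module ℝ (Reduction C) :=
  inferInstanceAs (Module ℝ (C ⧸ (sympAnn C).submoduleOf C))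

/-- The projection `π : C → F`. -/
def proj : C →ₗ[ℝ] Reduction C := ((sympAnn C).submoduleOf C).mkQ

theorem proj_surjective : Function.Surjective (proj C) := Submodule.mkQ_surjective _

theorem proj_eq_zero {v : C} : proj C v = 0 ↔ (v : E) ∈ sympAnn C :=
  (Submodule.Quotient.mk_eq_zero _).trans Iff.rfl

variable [IsCoisotropic C]

theorem bijective_proj_maxComplex :
    Function.Bijective
      (proj C ∘ₗ Submodule.inclusion (inf_le_left : maxComplex C ≤ C)) := by
  constructor
  · rw [← LinearMap.ker_eq_bot, LinearMap.ker_eq_bot']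
    rintro ⟨h, hh⟩ e
    have h1 : h ∈ sympAnn C := (proj_eq_zero C).1 e
    have h2 := h1 (J h) (J_mem_maxComplex hh).1
    rw [symp_swap, ← inner_eq, neg_eq_zero, inner_self_eq_zero] at h2
    exact Subtype.ext h2
  · intro x
    obtain ⟨v, rfl⟩ := proj_surjective C x
    set w : E := v - (sympAnn C).starProjection (v : E) with hw
    have hp : (sympAnn C).starProjection (v : E) ∈ sympAnn C :=
      Submodule.starProjection_apply_mem _ _
    have hwC : w ∈ C := C.sub_mem v.2 (IsCoisotropic.ann_le hp)
    have hwo : ∀ y ∈ sympAnn C, symp y (J w) = 0 := fun y hy => by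
      rw [← inner_eq]
      exact (Submodule.mem_orthogonal _ _).1
        (Submodule.sub_starProjection_mem_orthogonal (v : E)) y hy
    refine ⟨⟨w, hwC, -J w, C.neg_mem (mem_of_symp_eq_zero hwo), by simp [J_J]⟩, ?_⟩
    rw [← sub_eq_zero, LinearMap.comp_apply, ← map_sub, proj_eq_zero]
    simp [hw]

/-- The identification `H ≅ F` given by the restriction of `π` to the maximal complex subspace. -/
def horizontal : maxComplex C ≃ₗ[ℝ] Reduction C :=
  LinearEquiv.ofBijective _ (bijective_proj_maxComplex C)

theorem horizontal_apply (h : maxComplex C) : horizontal C h = proj C ⟨h, h.2.1⟩ := rfl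

instance : NormedAddCommGroup (Reduction C) :=
  NormedAddCommGroup.induced (Reduction C) (maxComplex C) (horizontal C).symm
    (horizontal C).symm.injective

/-- The inner product that `F` inherits from `H`. -/
instance : InnerProductSpace ℝ (Reduction C) :=
  InnerProductSpace.induced (horizontal C).symm

instance : FiniteDimensional ℝ (Reduction C) := (horizontal C).finiteDimensional

/-- The Kähler structure that `F` inherits from `H`. -/
instance : KahlerSpace (Reduction C) where
  J := (horizontal C).toLinearMap ∘ₗ
    (J : E →ₗ[ℝ] E).restrict (fun _ h => J_mem_maxComplex (C := C) h) ∘ₗ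
    (horizontal C).symm.toLinearMap
  symp := (symp : LinearMap.BilinForm ℝ E).compl₁₂
    ((maxComplex C).subtype ∘ₗ (horizontal C).symm.toLinearMap)
    ((maxComplex C).subtype ∘ₗ (horizontal C).symm.toLinearMap)
  J_J v := by
    apply (horizontal C).symm.injective
    apply Subtype.ext
    simp [J_J]
  symp_self v := symp_self _
  inner_eq u v := by
    have h : inner ℝ u v =
        inner ℝ ((horizontal C).symm u : E) ((horizontal C).symm v : E) := rfl
    rw [h, inner_eq]
    simp

/-- The symplectic form of `F` is the reduced one: `ω_F([u],[v]) = ω(u,v)` for `u, v ∈ C`. -/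
theorem symp_proj (u v : C) : symp (proj C u) (proj C v) = symp (u : E) (v : E) := by
  have key : ∀ u : C, ∃ y ∈ sympAnn C, (u : E) = (horizontal C).symm (proj C u) + y := fun u => by
    refine ⟨u - (horizontal C).symm (proj C u), ?_, by abel⟩
    have h : proj C (u - ⟨(horizontal C).symm (proj C u), ((horizontal C).symm (proj C u)).2.1⟩)
        = 0 := by
      rw [map_sub, ← horizontal_apply, LinearEquiv.apply_symm_apply, sub_self]
    exact (proj_eq_zero C).1 h
  obtain ⟨y, hy, ey⟩ := key u
  obtain ⟨z, hz, ez⟩ := key v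
  have e : symp (proj C u) (proj C v)
      = symp ((horizontal C).symm (proj C u) : E) ((horizontal C).symm (proj C v) : E) := rfl
  have h1 : symp ((horizontal C).symm (proj C u) : E) z = 0 :=
    hz _ ((horizontal C).symm (proj C u)).2.1
  have h2 : symp y (v : E) = 0 := by rw [symp_swap, hy _ v.2, neg_zero]
  rw [e]
  conv_rhs => rw [ey, map_add, LinearMap.add_apply, h2, ez, map_add, h1]
  simp

instance : MeasurableSpace (Reduction C) := borel _

instance : BorelSpace (Reduction C) := ⟨rfl⟩

variable {C}

theorem map_sympAnn (Φ : Sp E) (hC : C.map ((Φ : E ≃ₗ[ℝ] E) : E →ₗ[ℝ] E) = C) :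
    ((sympAnn C).submoduleOf C).map
      ((Φ : E ≃ₗ[ℝ] E).ofSubmodules C C hC : C →ₗ[ℝ] C) = (sympAnn C).submoduleOf C := by
  have hmem : ∀ u ∈ C, ∃ c ∈ C, (Φ : E ≃ₗ[ℝ] E) c = u := fun u hu => by
    rw [← hC] at hu
    exact hu
  have hmem' : ∀ c ∈ C, (Φ : E ≃ₗ[ℝ] E) c ∈ C := fun c hc =>
    hC.le (Submodule.mem_map_of_mem hc)
  ext v
  constructor
  · rintro ⟨y, hy, rfl⟩ u hu
    obtain ⟨c, hc, rfl⟩ := hmem u hu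
    exact (Φ.2 c y).trans (hy c hc)
  · intro hv
    obtain ⟨c, hc, e⟩ := hmem v v.2
    refine ⟨⟨c, hc⟩, fun u hu => ?_, Subtype.ext e⟩
    have h := hv _ (hmem' u hu)
    change symp _ (v : E) = 0 at h
    rw [← e, Φ.2 u c] at h
    exact h

/-- The reduced map `φ : F → F`, `φ([v]) = [Φ(v)]`, of a symplectic map `Φ` with `Φ(C) = C`. -/
def reducedMap (Φ : Sp E) (hC : C.map ((Φ : E ≃ₗ[ℝ] E) : E →ₗ[ℝ] E) = C) : Sp (Reduction C) :=
  ⟨Submodule.Quotient.equiv _ _ ((Φ : E ≃ₗ[ℝ] E).ofSubmodules C C hC) (map_sympAnn Φ hC), by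
    intro x y
    obtain ⟨u, rfl⟩ := proj_surjective C x
    obtain ⟨v, rfl⟩ := proj_surjective C y
    change symp (proj C ((Φ : E ≃ₗ[ℝ] E).ofSubmodules C C hC u))
      (proj C ((Φ : E ≃ₗ[ℝ] E).ofSubmodules C C hC v)) = _
    rw [symp_proj, symp_proj]
    exact Φ.2 u v⟩

theorem reducedMap_proj (Φ : Sp E) (hC : C.map ((Φ : E ≃ₗ[ℝ] E) : E →ₗ[ℝ] E) = C) (v : C) :
    (reducedMap Φ hC : Reduction C ≃ₗ[ℝ] Reduction C) (proj C v)
      = proj C ⟨(Φ : E ≃ₗ[ℝ] E) v, hC.le (Submodule.mem_map_of_mem v.2)⟩ := rfl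

variable [MeasurableSpace E] [BorelSpace E]

variable (C) in
/-- The reduction operator `R`: restriction to `C` followed by integration over (the translates
of) `C°` with respect to the Euclidean measure, `(Rψ)([v]) = ∫_{C°} ψ(v + y) dy`. -/
def reduce (ψ : E → ℂ) : Reduction C → ℂ :=
  Quotient.lift (s := ((sympAnn C).submoduleOf C).quotientRel)
    (fun v : C => ∫ y : sympAnn C, ψ ((v : E) + (y : E)) ∂volume) (by
      intro v w h
      have h' : (v : E) - w ∈ sympAnn C :=
        (Submodule.quotientRel_def ((sympAnn C).submoduleOf C)).1 h
      have := integral_add_right_eq_self (μ := (volume : Measure (sympAnn C)))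
        (fun y : sympAnn C => ψ ((w : E) + (y : E))) ⟨(v : E) - w, h'⟩
      refine Eq.trans (integral_congr_ae (Filter.Eventually.of_forall fun y => ?_)) this
      simp only [Submodule.coe_add]
      congr 1
      abel)

theorem reduce_proj (ψ : E → ℂ) (v : C) :
    reduce C ψ (proj C v) = ∫ y : sympAnn C, ψ ((v : E) + (y : E)) ∂volume := rfl

end Reduction
end BargmannReduction
end
open BargmannReduction

noncomputable section

set_option linter.unusedSectionVars false

namespace BargmannReduction

open KahlerSpace

/-! ### Moments of a density with smooth Fourier transform -/

section Moments

variable {X : Type*} [MeasurableSpace X] {μ : Measure X} {l : X → ℝ}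

/-! Write `H` for the maximal complex subspace of `C`. Since `H` is `J`-invariant, `H°` is its
orthogonal complement and is again complex, so `E` is the orthogonal Kähler sum of `F ≅ H` and `H°`,
with `C° ⊆ H°`. As `Φ` is symplectic and fixes `H°`, it preserves `H`, hence `Φ = φ ⊕ id`
(`map_reductionSplitting`). In this splitting `R` is integration over a subspace of the second
summand (`reduce_eq_fiberInt`), while `W(Φ)` acts on the first variable only: the reproducing kernel
is a product, and `U_Φ ψ` is still a Bargmann function of the second variable, so `P_E` acts on it
as `P_F` with that variable frozen (`kernProj_map`). Fubini's theorem then lets `P_F` pass under the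
fibre integral (`fiberInt_kernProj_slices`). The summand `H°` contributes a power of 2 to the
determinant, which the normalization cancels (`metaplecticFactor_eq`).

The analysis rests on one fact: the smooth vectors are the Bargmann functions of rapid decay. Up to
a Gaussian in `a`, the coefficient `⟨ρ(a)ψ, χ⟩` is a Fourier transform of `ψ` times the conjugate of
`χ` (`integral_heis_mul_conj`). Rapid decay therefore gives smoothness. Conversely, for `χ = ψ` the
density `|ψ|²` is nonnegative, and smoothness of its transform forces all moments to be finite; the
reproducing kernel turns this into pointwise decay (`rapidDecay_of_smooth`). Decay is stable under
linear changes of variable, projection and fibre integration. -/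

theorem norm_cexp_I_mul_ofReal (r : ℝ) : ‖Complex.exp (Complex.I * (r : ℂ))‖ = 1 := by
  rw [mul_comm]; exact Complex.norm_exp_ofReal_mul_I r

theorem integrable_osc_mul (hl : Measurable l) {g : X → ℂ} (hg : Integrable g μ) (t : ℝ) :
    Integrable (fun x => Complex.exp (Complex.I * ((t * l x : ℝ) : ℂ)) * g x) μ := by
  refine hg.bdd_mul (c := 1) ?_ (Filter.Eventually.of_forall fun x =>
    (norm_cexp_I_mul_ofReal _).le)
  exact (by fun_prop : Measurable fun x =>
    Complex.exp (Complex.I * ((t * l x : ℝ) : ℂ))).aestronglyMeasurable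

theorem hasDerivAt_integral_osc (hl : Measurable l) {g : X → ℂ} (hg : Integrable g μ)
    (hg' : Integrable (fun x => (l x : ℂ) * g x) μ) (t : ℝ) :
    HasDerivAt (fun t : ℝ => ∫ x, Complex.exp (Complex.I * ((t * l x : ℝ) : ℂ)) * g x ∂μ)
      (Complex.I * ∫ x, Complex.exp (Complex.I * ((t * l x : ℝ) : ℂ)) * ((l x : ℂ) * g x) ∂μ)
      t := by
  have h := hasDerivAt_integral_of_dominated_loc_of_deriv_le (μ := μ) (s := Set.univ) (x₀ := t)
    (F := fun (t : ℝ) x => Complex.exp (Complex.I * ((t * l x : ℝ) : ℂ)) * g x)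
    (F' := fun t x => Complex.I * (Complex.exp (Complex.I * ((t * l x : ℝ) : ℂ)) *
      ((l x : ℂ) * g x))) (bound := fun x => ‖(l x : ℂ) * g x‖) Filter.univ_mem
    (Filter.Eventually.of_forall fun t => (integrable_osc_mul hl hg t).aestronglyMeasurable)
    (integrable_osc_mul hl hg t)
    ((integrable_osc_mul hl hg' t).const_mul _).aestronglyMeasurable
    (Filter.Eventually.of_forall fun x t _ => ?_) hg'.norm
    (Filter.Eventually.of_forall fun x t _ => ?_)
  · simpa only [integral_const_mul] using h.2
  · rw [norm_mul, norm_mul, norm_cexp_I_mul_ofReal, Complex.norm_I, one_mul, one_mul]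
  · have h1 : HasDerivAt (fun t : ℝ => Complex.I * ((t * l x : ℝ) : ℂ))
        (Complex.I * ((1 * l x : ℝ) : ℂ)) t :=
      (((hasDerivAt_id t).mul_const (l x)).ofReal_comp).const_mul _
    refine (h1.cexp.mul_const (g x)).congr_deriv ?_
    push_cast; ring

/-- The symmetric second difference vanishes at 0 together with its first derivative, so its Taylor
polynomial of degree 1 is zero and only the quadratic remainder is left. -/
theorem second_difference_bound {φ : ℝ → ℂ} (hφ : ContDiff ℝ 2 φ) :
    ∃ c, ∀ t ∈ Set.Icc (0 : ℝ) 1, ‖φ t + φ (-t) - 2 * φ 0‖ ≤ c * t ^ 2 := by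
  set s : ℝ → ℂ := fun t => φ t + φ (-t) - 2 * φ 0 with hs
  have hsc : ContDiff ℝ 2 s := by
    have := hφ.comp (contDiff_neg (𝕜 := ℝ) (F := ℝ) (n := 2))
    exact (hφ.add this).sub contDiff_const
  have hd : HasDerivAt s 0 0 := by
    have h1 : HasDerivAt φ (deriv φ 0) 0 := (hφ.differentiable (by norm_num) 0).hasDerivAt
    have h2 : HasDerivAt (fun t => φ (-t)) (-deriv φ 0) 0 := by
      have h1' : HasDerivAt φ (deriv φ 0) (-0) := by rwa [neg_zero]
      simpa [Function.comp_def] using HasDerivAt.scomp (0 : ℝ) h1' (hasDerivAt_neg (0 : ℝ))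
    exact ((h1.add h2).sub_const (2 * φ 0)).congr_deriv (by simp)
  obtain ⟨c, hc⟩ := exists_taylor_mean_remainder_bound (n := 1) (f := s) (zero_le_one' ℝ)
    (by simpa [one_add_one_eq_two] using hsc.contDiffOn)
  refine ⟨c, fun t ht => ?_⟩
  have h := hc t ht
  have hw : derivWithin s (Set.Icc 0 1) 0 = 0 :=
    hd.hasDerivWithinAt.derivWithin (uniqueDiffOn_Icc_zero_one 0 (by simp))
  have h0 : s 0 = 0 := by simp [hs]; ring
  rw [taylorWithinEval_succ, taylor_within_zero_eval] at h
  simpa [iteratedDerivWithin_one, hw, h0] using h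

/-- Divided by `-t²`, the second difference of the transform at 0 is the integral of a nonnegative
function that tends to `l² g` as `t → 0`. These integrals stay bounded, and Fatou's lemma along `t =
1/(n+1)` gives the second moment. Nonnegativity of `g` is what excludes cancellation. -/
theorem sq_mul_integrable_of_contDiff (hl : Measurable l) {g : X → ℝ} (hg : Integrable g μ)
    (hg0 : ∀ x, 0 ≤ g x)
    (hφ : ContDiff ℝ 2
      fun t : ℝ => ∫ x, Complex.exp (Complex.I * ((t * l x : ℝ) : ℂ)) * (g x : ℂ) ∂μ) :
    Integrable (fun x => l x ^ 2 * g x) μ := by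
  obtain ⟨c, hc⟩ := second_difference_bound hφ
  have hgc : Integrable (fun x => (g x : ℂ)) μ := hg.ofReal
  have key : ∀ t : ℝ, 0 < t → t ≤ 1 →
      Integrable (fun x => (l x * Real.sinc (t * l x / 2)) ^ 2 * g x) μ ∧
      ∫ x, (l x * Real.sinc (t * l x / 2)) ^ 2 * g x ∂μ ≤ c := by
    intro t ht ht1
    -- The sum of the exponentials is `2 cos(tl) - 2 = -4 sin²(tl/2)`; writing it with `sinc`
    -- extracts `t²` without dividing by `l`.
    have hpt : ∀ x, Complex.exp (Complex.I * ((t * l x : ℝ) : ℂ)) * (g x : ℂ)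
        + Complex.exp (Complex.I * ((-t * l x : ℝ) : ℂ)) * (g x : ℂ)
        - 2 * (Complex.exp (Complex.I * ((0 * l x : ℝ) : ℂ)) * (g x : ℂ))
        = ((-t ^ 2 * ((l x * Real.sinc (t * l x / 2)) ^ 2 * g x) : ℝ) : ℂ) := by
      intro x
      have e1 : t * (l x * Real.sinc (t * l x / 2)) = 2 * Real.sin (t * l x / 2) := by
        by_cases h : l x = 0
        · simp [h]
        · rw [Real.sinc_of_ne_zero (by positivity)]
          field_simp
      have e2 : -t ^ 2 * ((l x * Real.sinc (t * l x / 2)) ^ 2 * g x)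
          = (2 * Real.cos (t * l x) - 2) * g x := by
        have e3 : Real.cos (t * l x) = 1 - 2 * Real.sin (t * l x / 2) ^ 2 := by
          have := Real.cos_two_mul (t * l x / 2)
          rw [mul_div_cancel₀ _ (two_ne_zero' ℝ)] at this
          rw [this, Real.cos_sq']; ring
        rw [e3]
        linear_combination (-(t * (l x * Real.sinc (t * l x / 2)))
          - 2 * Real.sin (t * l x / 2)) * g x * e1
      rw [e2, zero_mul, Complex.ofReal_zero, mul_zero, Complex.exp_zero]
      have e4 : Complex.I * ((-t * l x : ℝ) : ℂ) = ((-(t * l x) : ℝ) : ℂ) * Complex.I := by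
        push_cast; ring
      rw [mul_comm Complex.I, e4, Complex.exp_mul_I, Complex.exp_mul_I]
      push_cast
      rw [Complex.cos_neg, Complex.sin_neg]
      ring
    have hi := fun t : ℝ => integrable_osc_mul hl hgc t
    have hI : Integrable (fun x => ((-t ^ 2 * ((l x * Real.sinc (t * l x / 2)) ^ 2 * g x) : ℝ) : ℂ))
        μ := by
      simp only [← hpt]
      exact ((hi t).add (hi (-t))).sub ((hi 0).const_mul 2)
    have hI' : Integrable (fun x => (l x * Real.sinc (t * l x / 2)) ^ 2 * g x) μ := by
      refine (hI.re.const_mul (-(t ^ 2)⁻¹)).congr (Filter.Eventually.of_forall fun x => ?_)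
      simp only [RCLike.re_to_complex, Complex.ofReal_re]
      field_simp
    refine ⟨hI', ?_⟩
    have h := hc t ⟨ht.le, ht1⟩
    rw [← integral_add (hi t) (hi (-t)), ← integral_const_mul] at h
    erw [← integral_sub ((hi t).add (hi (-t))) ((hi 0).const_mul 2)] at h
    simp only [Pi.add_apply, hpt] at h
    rw [integral_complex_ofReal, Complex.norm_real, integral_const_mul, norm_mul,
      Real.norm_of_nonneg (integral_nonneg fun x => mul_nonneg (sq_nonneg _) (hg0 x)),
      norm_neg, Real.norm_of_nonneg (by positivity), mul_comm] at h
    exact le_of_mul_le_mul_right h (by positivity)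
  have hn : ∀ n : ℕ, 0 < 1 / ((n : ℝ) + 1) ∧ 1 / ((n : ℝ) + 1) ≤ 1 := fun n =>
    ⟨by positivity, by rw [div_le_one (by positivity)]; linarith [n.cast_nonneg (α := ℝ)]⟩
  suffices hlim : ∀ᵐ x ∂μ, Filter.Tendsto (fun (n : ℕ) =>
      (l x * Real.sinc (1 / ((n : ℝ) + 1) * l x / 2)) ^ 2 * g x) Filter.atTop
      (nhds (l x ^ 2 * g x)) by
    have hm := fun n : ℕ => (key _ (hn n).1 (hn n).2).1.aestronglyMeasurable
    refine ⟨aestronglyMeasurable_of_tendsto_ae _ hm hlim, lt_of_le_of_lt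
      ((lintegral_congr_ae (hlim.mono fun x hx => hx.enorm.liminf_eq.symm)).trans_le
        (lintegral_liminf_le' fun n => (hm n).aemeasurable.enorm))
      (lt_of_le_of_lt ?_ (ENNReal.ofReal_lt_top (r := c)))⟩
    refine Filter.liminf_le_of_le (by isBoundedDefault) fun b hb => ?_
    obtain ⟨n, hb⟩ := hb.exists
    refine hb.trans ?_
    obtain ⟨h1, h2⟩ := key _ (hn n).1 (hn n).2
    rw [← ofReal_integral_norm_eq_lintegral_enorm h1]
    refine ENNReal.ofReal_le_ofReal (le_trans (le_of_eq ?_) h2)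
    refine integral_congr_ae (Filter.Eventually.of_forall fun x => ?_)
    exact Real.norm_of_nonneg (mul_nonneg (sq_nonneg _) (hg0 x))
  refine Filter.Eventually.of_forall fun x => ?_
  · have h1 : Filter.Tendsto (fun n : ℕ => 1 / ((n : ℝ) + 1) * l x / 2) Filter.atTop (nhds 0) := by
      simpa using (tendsto_one_div_add_atTop_nhds_zero_nat (𝕜 := ℝ)).mul_const (l x) |>.div_const 2
    have h2 := ((Real.continuous_sinc.tendsto 0).comp h1).const_mul (l x)
    rw [Real.sinc_zero, mul_one] at h2
    exact (h2.pow 2).mul_const (g x)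

/-- Induction with `g` replaced by `l² g`, which is again nonnegative and whose transform is minus
the second derivative of the transform of `g`. -/
theorem even_pow_mul_integrable_of_contDiff (hl : Measurable l) {g : X → ℝ} (hg : Integrable g μ)
    (hg0 : ∀ x, 0 ≤ g x)
    (hφ : ContDiff ℝ ((⊤ : ℕ∞) : WithTop ℕ∞)
      fun t : ℝ => ∫ x, Complex.exp (Complex.I * ((t * l x : ℝ) : ℂ)) * (g x : ℂ) ∂μ) (k : ℕ) :
    Integrable (fun x => l x ^ (2 * k) * g x) μ := by
  induction k generalizing g with
  | zero => simpa using hg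
  | succ k ih =>
    have h2 : Integrable (fun x => l x ^ 2 * g x) μ :=
      sq_mul_integrable_of_contDiff hl hg hg0 (hφ.of_le (WithTop.coe_le_coe.2 (le_top : (2 : ℕ∞) ≤ ⊤)))
    -- Differentiating twice under the integral also needs the first moment; it is dominated by `g +
    -- l² g`.
    have h1 : Integrable (fun x => l x * g x) μ := by
      refine (hg.add h2).mono' (hl.aestronglyMeasurable.mul hg.aestronglyMeasurable)
        (Filter.Eventually.of_forall fun x => ?_)
      rw [Real.norm_eq_abs, abs_mul, abs_of_nonneg (hg0 x), Pi.add_apply]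
      nlinarith [hg0 x, sq_abs (l x), sq_nonneg (|l x| - 1), abs_nonneg (l x),
        mul_nonneg (hg0 x) (sq_nonneg (|l x| - 1)), mul_nonneg (hg0 x) (abs_nonneg (l x))]
    have c0 : Integrable (fun x => (g x : ℂ)) μ := hg.ofReal
    have c1 : Integrable (fun x => (l x : ℂ) * (g x : ℂ)) μ := by
      simpa using h1.ofReal (𝕜 := ℂ)
    have c2 : Integrable (fun x => (l x : ℂ) * ((l x : ℂ) * (g x : ℂ))) μ := by
      refine (h2.ofReal (𝕜 := ℂ)).congr (Filter.Eventually.of_forall fun x => ?_)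
      simp; ring
    have d1 : deriv (fun t : ℝ => ∫ x, Complex.exp (Complex.I * ((t * l x : ℝ) : ℂ)) * (g x : ℂ) ∂μ)
        = _ := funext fun t => (hasDerivAt_integral_osc hl c0 c1 t).deriv
    have d2 : deriv _ = _ :=
      funext fun t => ((hasDerivAt_integral_osc hl c1 c2 t).const_mul Complex.I).deriv
    have hs := (contDiff_infty_iff_deriv.1 (contDiff_infty_iff_deriv.1 hφ).2).2
    rw [d1, d2] at hs
    have := ih h2 (fun x => mul_nonneg (sq_nonneg _) (hg0 x)) (by
      refine (congrArg (ContDiff ℝ _) (funext fun t => ?_)).mp (hs.const_smul (-1 : ℂ))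
      rw [← mul_assoc, Complex.I_mul_I, smul_eq_mul, ← mul_assoc, neg_mul_neg, one_mul, one_mul]
      refine integral_congr_ae (Filter.Eventually.of_forall fun x => ?_)
      simp only; push_cast; ring)
    refine this.congr (Filter.Eventually.of_forall fun x => ?_)
    simp only; ring

end Moments

/-! ### The projector as an integral operator -/

section Projector

variable {E : Type*} [NormedAddCommGroup E] [InnerProductSpace ℝ E] [KahlerSpace E]
variable [FiniteDimensional ℝ E] [MeasurableSpace E] [BorelSpace E]

theorem conj_kexp (v w : E) : conj (kexp v w) = kexp w v := by
  rw [kexp_apply, kexp_apply, symp_swap w v, real_inner_comm]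
  simp

/-- The reproducing property, assuming only that the integral converges. -/
theorem kernInt_of_integrable {f : E → ℂ} (hf : IsHolomorphic f) (w : E)
    (hint : Integrable fun v => f v * (Real.exp (-‖v‖ ^ 2 / 2) : ℝ) * kern w v) :
    kernInt (fun v => f v * (Real.exp (-‖v‖ ^ 2 / 2) : ℝ)) w = gaussMass E * f w := by
  -- Translating by `w` and twisting by this holomorphic exponential completes the square, which
  -- reduces the claim to the Gaussian mean value at the origin.
  set h : E → ℂ := fun v => f (v + w) * Complex.exp (-kexp w v) with hh
  have hd : ∀ v, HasFDerivAt h (f (v + w) • (Complex.exp (-kexp w v) • (-kexp w)) +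
      Complex.exp (-kexp w v) • fderiv ℝ f (v + w)) v := by
    intro v
    have h1 : HasFDerivAt (fun v => f (v + w)) (fderiv ℝ f (v + w)) v :=
      (hasFDerivAt_comp_add_right w).2 (hf.1 _).hasFDerivAt
    exact h1.mul ((kexp w).hasFDerivAt.neg).cexp
  have hol : IsHolomorphic h := by
    refine ⟨fun v => (hd v).differentiableAt, fun v u => ?_⟩
    rw [(hd v).fderiv]
    simp only [add_apply, smul_apply, neg_apply, smul_eq_mul, kexp_J, hf.2]
    ring
  have key : ∀ v, h (v - w) * (Real.exp (-‖v - w‖ ^ 2) : ℝ)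
      = f v * (Real.exp (-‖v‖ ^ 2 / 2) : ℝ) * kern w v := by
    intro v
    have e : -kexp w (v - w) + ((-‖v - w‖ ^ 2 : ℝ) : ℂ)
        = ((-‖v‖ ^ 2 / 2 : ℝ) : ℂ) + (((-‖v‖ ^ 2 / 2 : ℝ) : ℂ) + kexp v w) := by
      rw [map_sub, kexp_apply, kexp_apply, kexp_apply, symp_self, symp_swap w v,
        real_inner_self_eq_norm_sq, real_inner_comm, @norm_sub_sq_real E]
      push_cast; ring
    simp only [hh, kern, sub_add_cancel, Complex.ofReal_exp]
    rw [mul_assoc, mul_assoc, ← Complex.exp_add, ← Complex.exp_add, ← Complex.exp_add, e]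
  have hint' : Integrable fun v => h v * (Real.exp (-‖v‖ ^ 2) : ℝ) := by
    simp only [← key] at hint
    simpa only [add_sub_cancel_right] using hint.comp_add_right w
  have := gauss_mean hol hint'
  rw [← integral_sub_right_eq_self _ w] at this
  simp only [key] at this
  rw [kernInt, this]
  simp [hh, gaussMass]

/-- Conjugation exchanges the two arguments of `kexp`, so the kernel, holomorphic in `w`, has a
conjugate whose exponential is holomorphic in `v`. -/
theorem conj_kern_mem_bargmann (w : E) : (fun v => conj (kern w v)) ∈ bargmann E := by
  refine ⟨⟨fun v => Complex.exp (kexp w v), ⟨fun v => ?_, fun v u => ?_⟩, fun v => ?_⟩,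
    (memLp_kern w).star⟩
  · exact ((kexp w).hasFDerivAt.cexp).differentiableAt
  · rw [((kexp w).hasFDerivAt.cexp).fderiv]
    simp only [smul_apply, smul_eq_mul, kexp_J]
    ring
  · simp only
    rw [kern, map_mul, Complex.conj_ofReal, ← Complex.exp_conj, conj_kexp, mul_comm]

/-- The projector is self-adjoint and fixes `φ`. -/
theorem integral_bargmannProj_mul_conj (u : Lp ℂ 2 (volume : Measure E)) {φ : E → ℂ}
    (hφ : φ ∈ bargmann E) :
    ∫ v, bargmannProj u v * conj (φ v) = ∫ v, u v * conj (φ v) := by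
  have e : ∀ x : Lp ℂ 2 (volume : Measure E),
      ∫ v, x v * conj (φ v) = inner ℂ (hφ.2.toLp φ) x := by
    intro x
    rw [L2.inner_def]
    refine integral_congr_ae ?_
    filter_upwards [hφ.2.coeFn_toLp] with v hv
    rw [hv, RCLike.inner_apply]
  have hmem : hφ.2.toLp φ ∈ bargmannL2 E := ⟨φ, hφ, hφ.2.coeFn_toLp⟩
  have h1 : ∫ v, bargmannProj u v * conj (φ v)
      = ∫ v, ((bargmannL2 E).starProjection u : Lp ℂ 2 (volume : Measure E)) v * conj (φ v) := by
    refine integral_congr_ae ?_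
    filter_upwards [bargmannProj_ae u] with v hv
    rw [hv]
  rw [h1, e, e, ← Submodule.inner_starProjection_left_eq_right,
    Submodule.starProjection_eq_self_iff.2 hmem]

/-- Evaluating a Bargmann function at `w` amounts to pairing it with the kernel at `w`; in that
pairing the projector can be dropped. The abstract projector thus becomes an integral formula to
which Fubini's theorem applies. -/
theorem bargmannProj_eq_kernProj (u : Lp ℂ 2 (volume : Measure E)) :
    bargmannProj u = kernProj u := by
  rw [← kernProj_of_mem (bargmannProj_mem u)]
  funext w
  have h := integral_bargmannProj_mul_conj u (conj_kern_mem_bargmann w)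
  simp only [Complex.conj_conj] at h
  rw [kernProj, kernProj, kernInt, kernInt, h]

theorem bargmannProj_toLp {u : E → ℂ} (hu : MemLp u 2 (volume : Measure E)) :
    bargmannProj (hu.toLp u) = kernProj u :=
  (bargmannProj_eq_kernProj _).trans (kernProj_congr hu.coeFn_toLp)

theorem metaplectic_apply (Φ : Sp E) (ψ : bargmann E) :
    (metaplectic Φ ψ : E → ℂ)
      = metaplecticFactor Φ • kernProj fun v => (ψ : E → ℂ) ((Φ : E ≃ₗ[ℝ] E).symm v) := by
  rw [← bargmannProj_toLp (memLp_comp_symm (Φ : E ≃ₗ[ℝ] E) ψ.2.2)]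
  rfl

theorem kernProj_mem_bargmann {u : E → ℂ} (hu : MemLp u 2 (volume : Measure E)) :
    kernProj u ∈ bargmann E := by
  rw [← bargmannProj_toLp hu]
  exact bargmannProj_mem _

/-- In modulus the normalized kernel is a Gaussian convolution kernel, which is why projecting
preserves decay. -/
theorem norm_kern_mul_exp (w v : E) :
    ‖kern w v‖ * Real.exp (-‖w‖ ^ 2 / 2) = Real.exp (-‖v - w‖ ^ 2 / 2) := by
  rw [kern, norm_mul, norm_cexp_kexp, Complex.norm_real, Real.norm_eq_abs, Real.abs_exp,
    ← Real.exp_add, ← Real.exp_add, @norm_sub_sq_real E]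
  congr 1; ring

theorem continuous_symp (a : E) : Continuous fun v : E => symp a v :=
  LinearMap.continuous_of_finiteDimensional (symp a)

theorem bargmann_continuous {ψ : E → ℂ} (hψ : ψ ∈ bargmann E) : Continuous ψ := by
  obtain ⟨⟨f, hf, e⟩, -⟩ := hψ
  have := hf.1.continuous
  rw [funext e]
  fun_prop

/-- Matrix coefficients of the Heisenberg representation are, up to a Gaussian factor, Fourier
transforms: `ρ(a)` is the Toeplitz operator with symbol `exp(‖a‖²/2 + 2iω(a,·))`. -/
theorem integral_heis_mul_conj {ψ φ : E → ℂ} (hψ : ψ ∈ bargmann E) (hφ : φ ∈ bargmann E) (a : E) :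
    ∫ v, heis a ψ v * conj (φ v) = (Real.exp (‖a‖ ^ 2 / 2) : ℝ) *
      ∫ v, Complex.exp (Complex.I * ((2 * symp a v : ℝ) : ℂ)) * (ψ v * conj (φ v)) := by
  set U : E → ℂ := fun v => Complex.exp (Complex.I * ((2 * symp a v : ℝ) : ℂ)) * ψ v with hU
  have hUc : Continuous U := by
    have h1 := continuous_symp a
    have h2 := bargmann_continuous hψ
    fun_prop
  have hUm : MemLp U 2 (volume : Measure E) := by
    refine hψ.2.of_le hUc.aestronglyMeasurable (Filter.Eventually.of_forall fun v => ?_)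
    rw [hU, norm_mul, norm_cexp_I_mul_ofReal, one_mul]
  obtain ⟨f, hf, e⟩ := hψ.1
  have hFd : ∀ v, HasFDerivAt (fun v => f v * Complex.exp (kexp a v))
      (f v • (Complex.exp (kexp a v) • kexp a) + Complex.exp (kexp a v) • fderiv ℝ f v) v :=
    fun v => (hf.1 v).hasFDerivAt.mul (kexp a).hasFDerivAt.cexp
  have hF : IsHolomorphic fun v => f v * Complex.exp (kexp a v) := by
    refine ⟨fun v => (hFd v).differentiableAt, fun v u => ?_⟩
    rw [(hFd v).fderiv]
    simp only [add_apply, smul_apply, smul_eq_mul, kexp_J, hf.2]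
    ring
  -- Since `2iω(a,v) = kexp a v - kexp v a`, the symbol splits into a factor holomorphic in `v`,
  -- absorbed into `f`, and one that moves the base point of the kernel from `w` to `w - a`.
  have hk : ∀ w v, f v * Complex.exp (kexp a v) * (Real.exp (-‖v‖ ^ 2 / 2) : ℝ) * kern (w - a) v
      = U v * kern w v := by
    intro w v
    have h1 : Complex.exp (kexp a v) * Complex.exp (kexp v (w - a))
        = Complex.exp (Complex.I * ((2 * symp a v : ℝ) : ℂ)) * Complex.exp (kexp v w) := by
      rw [← Complex.exp_add, ← Complex.exp_add, map_sub]
      congr 1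
      rw [kexp_apply a v, kexp_apply v a, symp_swap v a, real_inner_comm a v]
      push_cast; ring
    simp only [hU, e, kern]
    linear_combination (f v * (Real.exp (-‖v‖ ^ 2 / 2) : ℝ) * (Real.exp (-‖v‖ ^ 2 / 2) : ℝ)) * h1
  have hint : ∀ w, kernInt U w = gaussMass E * (f (w - a) * Complex.exp (kexp a (w - a))) := by
    intro w
    have hi : Integrable fun v => U v * kern w v := hUm.integrable_mul (memLp_kern w)
    simp only [← hk] at hi
    rw [← kernInt_of_integrable hF (w - a) hi]
    simp only [kernInt, hk]
  have hheis : ∀ w, heis a ψ w = (Real.exp (‖a‖ ^ 2 / 2) : ℝ) * kernProj U w := by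
    intro w
    have h0 : (gaussMass E : ℂ) ≠ 0 := by exact_mod_cast gaussMass_pos.ne'
    rw [kernProj, hint, inv_mul_cancel_left₀ h0, heis, e]
    have h1 : Complex.exp (Complex.I * (symp a w : ℝ)) * (Real.exp (-‖w - a‖ ^ 2 / 2) : ℝ)
        = (Real.exp (‖a‖ ^ 2 / 2) : ℝ) * Complex.exp (kexp a (w - a)) *
          (Real.exp (-‖w‖ ^ 2 / 2) : ℝ) := by
      rw [Complex.ofReal_exp, Complex.ofReal_exp, Complex.ofReal_exp, ← Complex.exp_add,
        ← Complex.exp_add, ← Complex.exp_add, map_sub, kexp_apply, kexp_apply, symp_self,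
        real_inner_self_eq_norm_sq, @norm_sub_sq_real E, real_inner_comm]
      congr 1
      push_cast; ring
    linear_combination f (w - a) * h1
  have h := integral_bargmannProj_mul_conj (hUm.toLp U) hφ
  rw [bargmannProj_toLp] at h
  simp only [hheis, mul_assoc]
  rw [integral_const_mul, h]
  congr 1
  refine integral_congr_ae ?_
  filter_upwards [hUm.coeFn_toLp] with v hv
  rw [hv, hU]
  ring

end Projector

/-! ### Rapidly decaying functions -/

/-- Decay faster than any power of the norm. -/
def RapidDecay {V : Type*} [NormedAddCommGroup V] (u : V → ℂ) : Prop :=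
  ∀ k : ℕ, ∃ c : ℝ, ∀ v, (1 + ‖v‖) ^ k * ‖u v‖ ≤ c

namespace RapidDecay

variable {V : Type*} [NormedAddCommGroup V] {u : V → ℂ}

/-- The condition on `g` is loose enough to cover linear isomorphisms, slices along a summand and
translates of a subspace alike. -/
theorem comp_of_norm_le {W : Type*} [NormedAddCommGroup W] (hu : RapidDecay u) {g : W → V} {K : ℝ}
    (hK : 0 ≤ K) (hg : ∀ w, ‖w‖ ≤ K * (1 + ‖g w‖)) : RapidDecay fun w => u (g w) := by
  intro k
  obtain ⟨c, hc⟩ := hu k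
  refine ⟨(K + 1) ^ k * c, fun w => ?_⟩
  have h1 : 1 + ‖w‖ ≤ (K + 1) * (1 + ‖g w‖) := by
    have := hg w
    have := norm_nonneg (g w)
    linarith
  calc (1 + ‖w‖) ^ k * ‖u (g w)‖ ≤ ((K + 1) * (1 + ‖g w‖)) ^ k * ‖u (g w)‖ := by gcongr
    _ = (K + 1) ^ k * ((1 + ‖g w‖) ^ k * ‖u (g w)‖) := by rw [mul_pow]; ring
    _ ≤ (K + 1) ^ k * c := by gcongr; exact hc _

theorem const_smul (hu : RapidDecay u) (a : ℂ) : RapidDecay (a • u) := by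
  intro k
  obtain ⟨c, hc⟩ := hu k
  refine ⟨‖a‖ * c, fun v => ?_⟩
  rw [Pi.smul_apply, norm_smul, mul_left_comm]
  gcongr
  exact hc v

theorem norm_pow_smul [NormedSpace ℝ V] (hu : RapidDecay u) (n : ℕ) :
    RapidDecay fun v => ((‖v‖ ^ n : ℝ) : ℂ) * u v := by
  intro k
  obtain ⟨c, hc⟩ := hu (k + n)
  refine ⟨c, fun v => le_trans ?_ (hc v)⟩
  rw [norm_mul, Complex.norm_real, Real.norm_of_nonneg (by positivity), pow_add, mul_assoc]
  gcongr
  linarith [norm_nonneg v]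

theorem exists_integrable_bound [InnerProductSpace ℝ V] [FiniteDimensional ℝ V]
    [MeasurableSpace V] [BorelSpace V] : ∃ r : ℕ,
      Integrable (fun v : V => ((1 + ‖v‖) ^ r)⁻¹) := by
  refine ⟨Module.finrank ℝ V + 1, ?_⟩
  have := integrable_one_add_norm (E := V) (μ := volume) (r := (Module.finrank ℝ V + 1 : ℕ))
    (by push_cast; linarith)
  refine this.congr (Filter.Eventually.of_forall fun v => ?_)
  simp only
  rw [Real.rpow_neg (by positivity), Real.rpow_natCast]

variable [InnerProductSpace ℝ V] [FiniteDimensional ℝ V] [MeasurableSpace V] [BorelSpace V]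

theorem integrable_weight (hu : RapidDecay u) (hm : AEStronglyMeasurable u volume) (k : ℕ) :
    Integrable fun v => (1 + ‖v‖) ^ k * ‖u v‖ := by
  obtain ⟨r, hr⟩ := exists_integrable_bound (V := V)
  obtain ⟨c, hc⟩ := hu (k + r)
  refine (hr.const_mul c).mono' ?_ (Filter.Eventually.of_forall fun v => ?_)
  · exact (by fun_prop : Continuous fun v : V => (1 + ‖v‖) ^ k).aestronglyMeasurable.mul hm.norm
  · rw [Real.norm_of_nonneg (by positivity), ← div_eq_mul_inv, le_div_iff₀ (by positivity)]
    refine le_trans (le_of_eq ?_) (hc v)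
    rw [pow_add]; ring

theorem integrable (hu : RapidDecay u) (hm : AEStronglyMeasurable u volume) :
    Integrable u := by
  rw [← integrable_norm_iff hm]
  simpa using hu.integrable_weight hm 0

theorem memLp_two (hu : RapidDecay u) (hm : AEStronglyMeasurable u volume) :
    MemLp u 2 (volume : Measure V) := by
  rw [memLp_two_iff_integrable_sq_norm hm]
  obtain ⟨c, hc⟩ := hu 0
  refine ((hu.integrable hm).norm.const_mul c).mono' (hm.norm.pow 2)
    (Filter.Eventually.of_forall fun v => ?_)
  rw [Real.norm_of_nonneg (by positivity), sq]
  gcongr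
  simpa using hc v

end RapidDecay

theorem exists_pow_mul_exp_le (k : ℕ) :
    ∃ c : ℝ, ∀ r : ℝ, 0 ≤ r → (1 + r) ^ k * Real.exp (-r ^ 2 / 2) ≤ c := by
  -- The polynomial is bounded by `k! e^(1+r)`, and `1 + r - r²/2 ≤ 3/2 ≤ 2`.
  refine ⟨k.factorial * Real.exp 2, fun r hr => ?_⟩
  have h1 : (1 + r) ^ k ≤ k.factorial * Real.exp (1 + r) := by
    have := Real.pow_div_factorial_le_exp (1 + r) (by positivity) k
    rwa [div_le_iff₀ (by positivity), mul_comm] at this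
  calc (1 + r) ^ k * Real.exp (-r ^ 2 / 2)
      ≤ k.factorial * Real.exp (1 + r) * Real.exp (-r ^ 2 / 2) := by gcongr
    _ = k.factorial * Real.exp (1 + r + -r ^ 2 / 2) := by rw [mul_assoc, ← Real.exp_add]
    _ ≤ k.factorial * Real.exp 2 := by
        gcongr
        nlinarith [sq_nonneg (r - 1)]

/-! ### Smooth vectors as rapidly decaying Bargmann functions -/

section Smooth

variable {E : Type*} [NormedAddCommGroup E] [InnerProductSpace ℝ E] [KahlerSpace E]
variable [FiniteDimensional ℝ E] [MeasurableSpace E] [BorelSpace E]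

/-- By `1 + ‖w‖ ≤ (1 + ‖v - w‖)(1 + ‖v‖)` a weight in `w` splits into one absorbed by the Gaussian
in `v - w` and one carried by `u`. Weighted integrability of `u` thus becomes pointwise decay. -/
theorem rapidDecay_kernProj {u : E → ℂ} (hu : ∀ k : ℕ, Integrable fun v => (1 + ‖v‖) ^ k * ‖u v‖) :
    RapidDecay (kernProj u) := by
  intro k
  obtain ⟨c, hc⟩ := exists_pow_mul_exp_le k
  refine ⟨(gaussMass E)⁻¹ * ∫ v, c * ((1 + ‖v‖) ^ k * ‖u v‖), fun w => ?_⟩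
  have h1 : ‖kernProj u w‖ = (gaussMass E)⁻¹ * (‖kernInt u w‖ * Real.exp (-‖w‖ ^ 2 / 2)) := by
    rw [kernProj, norm_mul, norm_mul, norm_inv, Complex.norm_real, Complex.norm_real,
      Real.norm_of_nonneg gaussMass_pos.le, Real.norm_of_nonneg (Real.exp_pos _).le, mul_assoc]
  rw [h1, mul_left_comm]
  refine mul_le_mul_of_nonneg_left ?_ (inv_nonneg.2 gaussMass_pos.le)
  have h2 : (1 + ‖w‖) ^ k * (‖kernInt u w‖ * Real.exp (-‖w‖ ^ 2 / 2))
      = ‖∫ v, (((1 + ‖w‖) ^ k * Real.exp (-‖w‖ ^ 2 / 2) : ℝ) : ℂ) * (u v * kern w v)‖ := by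
    rw [integral_const_mul, norm_mul, Complex.norm_real, Real.norm_of_nonneg (by positivity),
      kernInt]
    ring
  rw [h2]
  refine norm_integral_le_of_norm_le ((hu k).const_mul c) (Filter.Eventually.of_forall fun v => ?_)
  have h3 : 1 + ‖w‖ ≤ (1 + ‖v - w‖) * (1 + ‖v‖) := by
    have := norm_sub_le v (v - w)
    rw [sub_sub_cancel] at this
    nlinarith [norm_nonneg v, norm_nonneg (v - w)]
  calc ‖(((1 + ‖w‖) ^ k * Real.exp (-‖w‖ ^ 2 / 2) : ℝ) : ℂ) * (u v * kern w v)‖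
      = (1 + ‖w‖) ^ k * ‖u v‖ * (‖kern w v‖ * Real.exp (-‖w‖ ^ 2 / 2)) := by
        rw [norm_mul, norm_mul, Complex.norm_real, Real.norm_of_nonneg (by positivity)]
        ring
    _ ≤ ((1 + ‖v - w‖) * (1 + ‖v‖)) ^ k * ‖u v‖ * Real.exp (-‖v - w‖ ^ 2 / 2) := by
        rw [norm_kern_mul_exp]
        gcongr
    _ = ((1 + ‖v - w‖) ^ k * Real.exp (-‖v - w‖ ^ 2 / 2)) * ((1 + ‖v‖) ^ k * ‖u v‖) := by
        rw [mul_pow]; ring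
    _ ≤ c * ((1 + ‖v‖) ^ k * ‖u v‖) := by
        gcongr
        exact hc _ (norm_nonneg _)

/-- Each power of `‖v‖` times `ψ` is still square integrable, hence integrable against any `φ` in
`L²`; a Fourier transform with all absolute moments finite is smooth. -/
theorem mem_smoothVectors_of_rapidDecay {ψ : E → ℂ} (hψ : ψ ∈ bargmann E) (hr : RapidDecay ψ) :
    ψ ∈ smoothVectors E := by
  refine ⟨hψ, fun φ hφ => ?_⟩
  simp only [integral_heis_mul_conj hψ hφ]
  have hc1 := bargmann_continuous hψ
  have hc2 := bargmann_continuous hφ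
  -- The factor `1/π` turns the convention `exp(-2πi L(v,a))` into `exp(-2iω(v,a)) = exp(2iω(a,v))`.
  let L : E →L[ℝ] E →L[ℝ] ℝ := LinearMap.toContinuousLinearMap
    ((LinearMap.toContinuousLinearMap : (E →ₗ[ℝ] ℝ) ≃ₗ[ℝ] E →L[ℝ] ℝ).toLinearMap ∘ₗ
      ((Real.pi)⁻¹ • (symp : LinearMap.BilinForm ℝ E)))
  have hL : ∀ v a, L v a = (Real.pi)⁻¹ * symp v a := fun v a => rfl
  have h := VectorFourier.contDiff_fourierIntegral (μ := (volume : Measure E)) L (N := ⊤)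
    (f := fun v => ψ v * conj (φ v)) fun n _ => by
      have h1 : MemLp (fun v => ((‖v‖ ^ n : ℝ) : ℂ) * ψ v) 2 (volume : Measure E) :=
        (hr.norm_pow_smul n).memLp_two (by fun_prop : Continuous _).aestronglyMeasurable
      refine (h1.integrable_mul hφ.2.star).norm.congr (Filter.Eventually.of_forall fun v => ?_)
      simp [mul_assoc]
  refine ContDiff.mul ?_ ?_
  · exact Complex.ofRealCLM.contDiff.comp
      (Real.contDiff_exp.comp ((contDiff_norm_sq ℝ).div_const 2))
  · refine (congrArg (ContDiff ℝ _) (funext fun a => ?_)).mp h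
    rw [VectorFourier.fourierIntegral]
    refine integral_congr_ae (Filter.Eventually.of_forall fun v => ?_)
    simp only [Circle.smul_def, Real.fourierChar_apply,
      smul_eq_mul]
    congr 2
    change ((2 * Real.pi * -(L v a) : ℝ) : ℂ) * Complex.I = _
    have : 2 * Real.pi * -(L v a) = 2 * symp a v := by
      rw [hL, symp_swap v a]
      field_simp [Real.pi_ne_zero]
    rw [this, mul_comm]

/-- Pairing `ρ(a)ψ` with `ψ` itself gives the transform of the nonnegative density `|ψ|²`. Its
restriction to each line through the origin is smooth, which yields the moments of every coordinate,
and these control the powers of the norm. -/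
theorem integrable_weight_sq_of_smooth {ψ : E → ℂ} (hψ : ψ ∈ smoothVectors E) (k : ℕ) :
    Integrable fun v => (1 + ‖v‖) ^ (2 * k) * ‖ψ v‖ ^ 2 := by
  have hc := bargmann_continuous hψ.1
  have h0 : Integrable fun v => ‖ψ v‖ ^ 2 :=
    (memLp_two_iff_integrable_sq_norm hc.aestronglyMeasurable).1 hψ.1.2
  have hF := hψ.2 ψ hψ.1
  simp only [integral_heis_mul_conj hψ.1 hψ.1] at hF
  have hF' : ContDiff ℝ ((⊤ : ℕ∞) : WithTop ℕ∞) fun a : E =>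
      ∫ v, Complex.exp (Complex.I * ((2 * symp a v : ℝ) : ℂ)) * ((‖ψ v‖ ^ 2 : ℝ) : ℂ) := by
    have h1 : ContDiff ℝ ((⊤ : ℕ∞) : WithTop ℕ∞)
        fun a : E => ((Real.exp (-(‖a‖ ^ 2 / 2)) : ℝ) : ℂ) :=
      Complex.ofRealCLM.contDiff.comp
        (Real.contDiff_exp.comp ((contDiff_norm_sq ℝ).div_const 2).neg)
    refine (congrArg (ContDiff ℝ _) (funext fun a => ?_)).mp (h1.mul hF)
    simp only [Complex.mul_conj, Complex.normSq_eq_norm_sq]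
    rw [← mul_assoc, ← Complex.ofReal_mul, ← Real.exp_add, neg_add_cancel, Real.exp_zero,
      Complex.ofReal_one, one_mul]
  have hmom : ∀ a : E, Integrable fun v => inner ℝ a v ^ (2 * k) * ‖ψ v‖ ^ 2 := by
    intro a
    have hl : Measurable fun v : E => inner ℝ a v :=
      (by fun_prop : Continuous fun v : E => inner ℝ a v).measurable
    refine even_pow_mul_integrable_of_contDiff hl h0 (fun v => sq_nonneg _) ?_ k
    -- On this line the phase `2ω(·, v)` equals `t ⟨a, v⟩`.
    have hlin : ContDiff ℝ ((⊤ : ℕ∞) : WithTop ℕ∞) fun t : ℝ => (-t / 2) • J a := by fun_prop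
    refine (congrArg (ContDiff ℝ _) (funext fun t => ?_)).mp (hF'.comp hlin)
    refine integral_congr_ae (Filter.Eventually.of_forall fun v => ?_)
    simp only
    have : 2 * symp ((-t / 2) • J a) v = t * inner ℝ a v := by
      rw [map_smul, LinearMap.smul_apply, ← inner_J_left, J_J, inner_neg_left, smul_eq_mul]
      ring
    rw [this]
  set b := stdOrthonormalBasis ℝ E
  set n := Fintype.card (Fin (Module.finrank ℝ E)) with hn
  have hsum : Integrable fun v => (2 : ℝ) ^ (2 * k) * (2 * ‖ψ v‖ ^ 2 +
      (n : ℝ) ^ (k - 1) * ∑ i, inner ℝ (b i) v ^ (2 * k) * ‖ψ v‖ ^ 2) :=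
    ((h0.const_mul 2).add ((integrable_finsetSum _ fun i _ => hmom (b i)).const_mul _)).const_mul _
  refine hsum.mono' (by fun_prop : Continuous _).aestronglyMeasurable
    (Filter.Eventually.of_forall fun v => ?_)
  -- For `k ≥ 1` this is the power mean inequality; the summand 1 takes care of `k = 0`, where `k -
  -- 1` is truncated.
  have h2 : ‖v‖ ^ (2 * k) ≤ 1 + (n : ℝ) ^ (k - 1) * ∑ i, inner ℝ (b i) v ^ (2 * k) := by
    simp only [pow_mul]
    rw [← b.sum_sq_inner_right v]
    cases k with
    | zero => simp
    | succ k =>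
      have h := pow_sum_div_card_le_sum_pow (s := Finset.univ)
        (f := fun i => inner ℝ (b i) v ^ 2) (fun i _ => sq_nonneg _) k
      rw [Finset.card_univ, ← hn] at h
      rcases Nat.eq_zero_or_pos n with h0 | h0
      · have : IsEmpty (Fin (Module.finrank ℝ E)) := Fintype.card_eq_zero_iff.1 h0
        simp
      · rw [div_le_iff₀' (by positivity)] at h
        simpa using h.trans (by linarith)
  have h3 : (1 + ‖v‖) ^ (2 * k) ≤ 2 ^ (2 * k) * (1 + ‖v‖ ^ (2 * k)) := by
    calc (1 + ‖v‖) ^ (2 * k) ≤ (2 * max 1 ‖v‖) ^ (2 * k) := by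
          gcongr
          linarith [le_max_left 1 ‖v‖, le_max_right 1 ‖v‖]
      _ = 2 ^ (2 * k) * max 1 ‖v‖ ^ (2 * k) := mul_pow _ _ _
      _ ≤ 2 ^ (2 * k) * (1 + ‖v‖ ^ (2 * k)) := by
          gcongr
          rcases max_cases 1 ‖v‖ with h | h <;> rw [h.1]
          · simp only [one_pow]; linarith [pow_nonneg (norm_nonneg v) (2 * k)]
          · linarith
  rw [Real.norm_of_nonneg (by positivity), ← Finset.sum_mul]
  calc (1 + ‖v‖) ^ (2 * k) * ‖ψ v‖ ^ 2
      ≤ 2 ^ (2 * k) * (1 + (1 + (n : ℝ) ^ (k - 1) * ∑ i, inner ℝ (b i) v ^ (2 * k))) * ‖ψ v‖ ^ 2 := by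
        gcongr
        exact h3.trans (by gcongr)
    _ = _ := by ring

/-- Weighted `L²` bounds of all orders give weighted `L¹` bounds, and `ψ`, being its own projection,
inherits pointwise decay from them. -/
theorem rapidDecay_of_smooth {ψ : E → ℂ} (hψ : ψ ∈ smoothVectors E) : RapidDecay ψ := by
  have hc := bargmann_continuous hψ.1
  rw [← kernProj_of_mem hψ.1]
  refine rapidDecay_kernProj fun k => ?_
  obtain ⟨r, hr⟩ := RapidDecay.exists_integrable_bound (V := E)
  refine ((integrable_weight_sq_of_smooth hψ (k + r)).add hr).mono'
    (by fun_prop : Continuous _).aestronglyMeasurable (Filter.Eventually.of_forall fun v => ?_)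
  have h1 : 1 ≤ 1 + ‖v‖ := by linarith [norm_nonneg v]
  have h2 : 1 ≤ (1 + ‖v‖) ^ r := one_le_pow₀ h1
  rw [Real.norm_of_nonneg (by positivity), Pi.add_apply]
  set x := (1 + ‖v‖) ^ r
  set y := (1 + ‖v‖) ^ k * ‖ψ v‖ with hy
  have e : (1 + ‖v‖) ^ (2 * (k + r)) * ‖ψ v‖ ^ 2 = y ^ 2 * x ^ 2 := by
    rw [hy, mul_pow, ← pow_mul, ← pow_mul]; ring
  rw [e]
  have hx0 : 0 < x := by positivity
  -- After division by `x` this reads `y ≤ y² x² + x⁻¹`, a pointwise substitute for Cauchy–Schwarz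
  -- in which `x⁻¹` is integrable by the choice of `r`.
  have h3 : y * x ≤ y ^ 2 * x ^ 3 + 1 := by
    nlinarith [sq_nonneg (y * x - 1), mul_nonneg (sq_nonneg (y * x)) (sub_nonneg.2 h2)]
  have h4 : y ^ 2 * x ^ 2 + x⁻¹ = (y ^ 2 * x ^ 3 + 1) / x := by field_simp
  rw [h4, le_div_iff₀ hx0]
  exact h3

theorem norm_le_of_linearEquiv (Φ : E ≃ₗ[ℝ] E) : ∃ K : ℝ, 0 ≤ K ∧ ∀ v, ‖v‖ ≤ K * (1 + ‖Φ v‖) := by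
  refine ⟨‖LinearMap.toContinuousLinearMap Φ.symm.toLinearMap‖, norm_nonneg _, fun v => ?_⟩
  have h := (LinearMap.toContinuousLinearMap Φ.symm.toLinearMap).le_opNorm (Φ v)
  simp only [LinearMap.coe_toContinuousLinearMap', LinearEquiv.coe_coe,
    LinearEquiv.symm_apply_apply] at h
  refine h.trans ?_
  gcongr
  linarith

theorem RapidDecay.comp_symm {u : E → ℂ} (hu : RapidDecay u) (Φ : E ≃ₗ[ℝ] E) :
    RapidDecay fun v => u (Φ.symm v) := by
  obtain ⟨K, hK, h⟩ := norm_le_of_linearEquiv Φ.symm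
  exact hu.comp_of_norm_le hK h

theorem continuous_comp_symm {u : E → ℂ} (hu : Continuous u) (Φ : E ≃ₗ[ℝ] E) :
    Continuous fun v => u (Φ.symm v) :=
  hu.comp (LinearMap.continuous_of_finiteDimensional Φ.symm.toLinearMap)

theorem metaplectic_mem_smoothVectors (Φ : Sp E) (ψ : bargmann E)
    (hψ : (ψ : E → ℂ) ∈ smoothVectors E) : (metaplectic Φ ψ : E → ℂ) ∈ smoothVectors E := by
  refine mem_smoothVectors_of_rapidDecay (metaplectic Φ ψ).2 ?_
  rw [metaplectic_apply]
  refine RapidDecay.const_smul (rapidDecay_kernProj fun k => ?_) _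
  exact ((rapidDecay_of_smooth hψ).comp_symm _).integrable_weight
    (continuous_comp_symm (bargmann_continuous ψ.2) _).aestronglyMeasurable k

end Smooth

/-! ### Orthogonal splittings of Kähler spaces -/

/-- An identification of `E` with the orthogonal direct sum of the Kähler spaces `F` and `L`. -/
structure KahlerSplitting (F L E : Type*)
    [NormedAddCommGroup F] [InnerProductSpace ℝ F] [KahlerSpace F]
    [NormedAddCommGroup L] [InnerProductSpace ℝ L] [KahlerSpace L]
    [NormedAddCommGroup E] [InnerProductSpace ℝ E] [KahlerSpace E] where
  /-- the underlying linear isomorphism -/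
  equiv : (F × L) ≃ₗ[ℝ] E
  inner_map : ∀ p q, inner ℝ (equiv p) (equiv q) = inner ℝ p.1 q.1 + inner ℝ p.2 q.2
  J_map : ∀ p, J (equiv p) = equiv (J p.1, J p.2)

/-! ### Restriction of Bargmann functions to complex affine subspaces -/

section Slice

variable {V E : Type*} [NormedAddCommGroup V] [InnerProductSpace ℝ V] [KahlerSpace V]
  [FiniteDimensional ℝ V] [MeasurableSpace V] [BorelSpace V]
  [NormedAddCommGroup E] [InnerProductSpace ℝ E] [KahlerSpace E]
  [FiniteDimensional ℝ E] [MeasurableSpace E] [BorelSpace E]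

/-- By Pythagoras the Gaussian factors on the slice, and its constant part joins the holomorphic
factor. Square integrability is read off from the decay of `ψ`. -/
theorem slice_mem_bargmann {ψ : E → ℂ} (hψ : ψ ∈ bargmann E) (hr : RapidDecay ψ)
    (i : V →L[ℝ] E) (hJ : ∀ x, i (J x) = J (i x)) (y : E)
    (hn : ∀ x, ‖i x + y‖ ^ 2 = ‖x‖ ^ 2 + ‖y‖ ^ 2) :
    (fun x => ψ (i x + y)) ∈ bargmann V := by
  have hc := bargmann_continuous hψ
  obtain ⟨f, hf, e⟩ := hψ.1
  have hd : ∀ x, HasFDerivAt (fun x => f (i x + y) * (Real.exp (-‖y‖ ^ 2 / 2) : ℝ))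
      ((Real.exp (-‖y‖ ^ 2 / 2) : ℝ) • ((fderiv ℝ f (i x + y)).comp i)) x := by
    intro x
    have h1 : HasFDerivAt (fun x => i x + y) i x := i.hasFDerivAt.add_const y
    have h2 := ((hf.1 (i x + y)).hasFDerivAt.comp x h1).mul_const
      ((Real.exp (-‖y‖ ^ 2 / 2) : ℝ) : ℂ)
    refine h2.congr_fderiv ?_
    ext u
    simp
  refine ⟨⟨fun x => f (i x + y) * (Real.exp (-‖y‖ ^ 2 / 2) : ℝ),
    ⟨fun x => (hd x).differentiableAt, fun x u => ?_⟩, fun x => ?_⟩, ?_⟩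
  · rw [(hd x).fderiv]
    simp only [smul_apply, ContinuousLinearMap.comp_apply, hJ, hf.2, Complex.real_smul]
    ring
  · simp only
    rw [e, mul_assoc, ← Complex.ofReal_mul, ← Real.exp_add, neg_div, hn]
    congr 3
    ring
  · refine RapidDecay.memLp_two (hr.comp_of_norm_le (K := 1) zero_le_one fun x => ?_)
      (by fun_prop : Continuous _).aestronglyMeasurable
    have : ‖x‖ ≤ ‖i x + y‖ := by
      refine le_of_sq_le_sq ?_ (norm_nonneg _)
      rw [hn]
      linarith [sq_nonneg ‖y‖]
    linarith

end Slice

/-- In odd dimension `J² = -1` would give `(det J)² = -1`. Evenness makes the truncated division in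
`metaplecticFactor` exact. -/
theorem even_finrank (V : Type*) [NormedAddCommGroup V] [InnerProductSpace ℝ V] [KahlerSpace V]
    [FiniteDimensional ℝ V] : Even (Module.finrank ℝ V) := by
  by_contra h
  rw [Nat.not_even_iff_odd] at h
  have h1 : (J : V →ₗ[ℝ] V) ∘ₗ J = (-1 : ℝ) • LinearMap.id := by
    ext v
    simp [J_J]
  have h2 := congrArg LinearMap.det h1
  rw [LinearMap.det_comp, LinearMap.det_smul, LinearMap.det_id, h.neg_one_pow] at h2
  nlinarith [mul_self_nonneg (LinearMap.det (J : V →ₗ[ℝ] V))]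

theorem kernInt_of_mem {V : Type*} [NormedAddCommGroup V] [InnerProductSpace ℝ V] [KahlerSpace V]
    [FiniteDimensional ℝ V] [MeasurableSpace V] [BorelSpace V] {φ : V → ℂ} (hφ : φ ∈ bargmann V)
    (l : V) : kernInt φ l = gaussMass V * (Real.exp (‖l‖ ^ 2 / 2) : ℝ) * φ l := by
  have h := congrFun (kernProj_of_mem hφ) l
  have h0 : (gaussMass V : ℂ) ≠ 0 := by exact_mod_cast gaussMass_pos.ne'
  have h1 : ((Real.exp (‖l‖ ^ 2 / 2) : ℝ) : ℂ) * (Real.exp (-‖l‖ ^ 2 / 2) : ℝ) = 1 := by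
    rw [← Complex.ofReal_mul, ← Real.exp_add, neg_div, add_neg_cancel, Real.exp_zero,
      Complex.ofReal_one]
  rw [kernProj] at h
  rw [← h]
  generalize ((Real.exp (-‖l‖ ^ 2 / 2) : ℝ) : ℂ) = q at h1 ⊢
  field_simp
  linear_combination (-kernInt φ l) * h1

namespace KahlerSplitting

variable {F L E : Type*}
  [NormedAddCommGroup F] [InnerProductSpace ℝ F] [KahlerSpace F] [FiniteDimensional ℝ F]
  [NormedAddCommGroup L] [InnerProductSpace ℝ L] [KahlerSpace L] [FiniteDimensional ℝ L]
  [NormedAddCommGroup E] [InnerProductSpace ℝ E] [KahlerSpace E] [FiniteDimensional ℝ E]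
  (S : KahlerSplitting F L E)

theorem norm_sq_map (p : F × L) : ‖S.equiv p‖ ^ 2 = ‖p.1‖ ^ 2 + ‖p.2‖ ^ 2 := by
  rw [← real_inner_self_eq_norm_sq, S.inner_map, real_inner_self_eq_norm_sq,
    real_inner_self_eq_norm_sq]

theorem symp_map (p q : F × L) :
    symp (S.equiv p) (S.equiv q) = symp p.1 q.1 + symp p.2 q.2 := by
  rw [← inner_J_left, S.J_map, S.inner_map, inner_J_left, inner_J_left]

theorem norm_fst_le (p : F × L) : ‖p.1‖ ≤ ‖S.equiv p‖ := by
  refine le_of_sq_le_sq ?_ (norm_nonneg _)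
  rw [S.norm_sq_map]
  linarith [sq_nonneg ‖p.2‖]

theorem norm_snd_le (p : F × L) : ‖p.2‖ ≤ ‖S.equiv p‖ := by
  refine le_of_sq_le_sq ?_ (norm_nonneg _)
  rw [S.norm_sq_map]
  linarith [sq_nonneg ‖p.1‖]

theorem continuous_equiv : Continuous S.equiv :=
  LinearMap.continuous_of_finiteDimensional S.equiv.toLinearMap

theorem map_add_map (x : F) (l : L) : S.equiv (x, 0) + S.equiv (0, l) = S.equiv (x, l) := by
  rw [← map_add]
  simp

theorem kern_map [MeasurableSpace F] [BorelSpace F] [MeasurableSpace L] [BorelSpace L]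
    [MeasurableSpace E] [BorelSpace E] (p q : F × L) :
    kern (S.equiv p) (S.equiv q) = kern p.1 q.1 * kern p.2 q.2 := by
  simp only [kern, kexp_apply, Complex.ofReal_exp, ← Complex.exp_add, neg_div, S.norm_sq_map,
    S.symp_map, S.inner_map]
  congr 1
  push_cast
  ring

/-! ### The metaplectic factor -/

/-- The complexified identification. -/
def complexEquiv : ((ℂ ⊗[ℝ] F) × (ℂ ⊗[ℝ] L)) ≃ₗ[ℂ] ℂ ⊗[ℝ] E :=
  (TensorProduct.prodRight ℝ ℂ ℂ F L).symm ≪≫ₗ S.equiv.baseChange ℝ ℂ (F × L) E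

theorem baseChange_complexEquiv (T : E →ₗ[ℝ] E) (A : F →ₗ[ℝ] F) (B : L →ₗ[ℝ] L)
    (h : ∀ p, T (S.equiv p) = S.equiv (A p.1, B p.2)) :
    LinearMap.baseChange ℂ T = (S.complexEquiv : _ →ₗ[ℂ] _) ∘ₗ
      ((LinearMap.baseChange ℂ A).prodMap (LinearMap.baseChange ℂ B)) ∘ₗ
      (S.complexEquiv.symm : _ →ₗ[ℂ] _) := by
  have hT : T = S.equiv.toLinearMap ∘ₗ (A.prodMap B) ∘ₗ S.equiv.symm.toLinearMap := by
    ext v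
    obtain ⟨p, rfl⟩ := S.equiv.surjective v
    simp [h]
  subst hT
  refine TensorProduct.AlgebraTensorModule.ext fun z v => ?_
  obtain ⟨⟨x, l⟩, rfl⟩ := S.equiv.surjective v
  simp [complexEquiv]

/-- A symplectic map that is trivial on the second summand has the same metaplectic factor as its
restriction to the first one. -/
theorem metaplecticFactor_eq [MeasurableSpace F] [BorelSpace F] [MeasurableSpace L] [BorelSpace L]
    [MeasurableSpace E] [BorelSpace E] (Φ : Sp E) (φ : Sp F)
    (h : ∀ p, (Φ : E ≃ₗ[ℝ] E) (S.equiv p) = S.equiv ((φ : F ≃ₗ[ℝ] F) p.1, p.2)) :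
    metaplecticFactor Φ = metaplecticFactor φ := by
  have hJ := S.baseChange_complexEquiv J J J S.J_map
  have hΦ := S.baseChange_complexEquiv ((Φ : E ≃ₗ[ℝ] E) : E →ₗ[ℝ] E)
    ((φ : F ≃ₗ[ℝ] F) : F →ₗ[ℝ] F) LinearMap.id h
  obtain ⟨m, hm⟩ := even_finrank L
  obtain ⟨n, hn⟩ := even_finrank F
  have hE : Module.finrank ℝ E = (n + n) + (m + m) := by
    rw [← S.equiv.finrank_eq, Module.finrank_prod, hn, hm]
  -- The operator is block diagonal; where the map is trivial the block is `(1 - iJ) + (1 + iJ) =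
  -- 2`, on a space of complex dimension `dim_ℝ L = m + m`.
  have hdet : LinearMap.det ((1 - Complex.I • LinearMap.baseChange ℂ (J : E →ₗ[ℝ] E)) +
        LinearMap.baseChange ℂ ((Φ : E ≃ₗ[ℝ] E) : E →ₗ[ℝ] E) *
          (1 + Complex.I • LinearMap.baseChange ℂ (J : E →ₗ[ℝ] E)))
      = LinearMap.det ((1 - Complex.I • LinearMap.baseChange ℂ (J : F →ₗ[ℝ] F)) +
        LinearMap.baseChange ℂ ((φ : F ≃ₗ[ℝ] F) : F →ₗ[ℝ] F) *
          (1 + Complex.I • LinearMap.baseChange ℂ (J : F →ₗ[ℝ] F)))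
        * (2 : ℂ) ^ (m + m) := by
    have h2 : (2 : ℂ) ^ (m + m) = LinearMap.det ((1 - Complex.I • LinearMap.baseChange ℂ
        (J : L →ₗ[ℝ] L)) + LinearMap.baseChange ℂ (LinearMap.id : L →ₗ[ℝ] L) *
          (1 + Complex.I • LinearMap.baseChange ℂ (J : L →ₗ[ℝ] L))) := by
      have : (1 - Complex.I • LinearMap.baseChange ℂ
        (J : L →ₗ[ℝ] L)) + LinearMap.baseChange ℂ (LinearMap.id : L →ₗ[ℝ] L) *
          (1 + Complex.I • LinearMap.baseChange ℂ (J : L →ₗ[ℝ] L)) = (2 : ℂ) • LinearMap.id := by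
        rw [LinearMap.baseChange_id]
        ext v
        simp [two_smul]
      rw [this, LinearMap.det_smul, LinearMap.det_id, mul_one, Module.finrank_baseChange, hm]
    rw [h2, ← LinearMap.det_prodMap, ← LinearMap.det_conj _ S.complexEquiv, hJ, hΦ]
    congr 1
    refine LinearMap.ext fun v => ?_
    obtain ⟨p, rfl⟩ := S.complexEquiv.surjective v
    simp only [LinearMap.add_apply, LinearMap.sub_apply, LinearMap.smul_apply, Module.End.mul_apply,
      Module.End.one_apply, LinearMap.comp_apply, LinearEquiv.coe_coe, LinearEquiv.symm_apply_apply,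
      LinearMap.prodMap_apply, ← S.complexEquiv.map_smul]
    rw [← map_sub S.complexEquiv, ← map_add S.complexEquiv p, LinearEquiv.symm_apply_apply,
      ← map_add S.complexEquiv]
    rfl
  -- The principal root is not multiplicative in general, but a positive real factor leaves the
  -- argument unchanged.
  have hsqrt : ∀ d : ℂ, (d * (2 : ℂ) ^ (m + m)) ^ (1 / 2 : ℂ) = d ^ (1 / 2 : ℂ) * 2 ^ m := by
    intro d
    by_cases hd : d = 0
    · simp [hd]
    have h2 : (0 : ℝ) < 2 ^ m := by positivity
    have e : (2 : ℂ) ^ (m + m) = (((2 ^ m * 2 ^ m : ℝ)) : ℂ) := by push_cast; rw [pow_add]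
    have e' : (2 : ℂ) ^ m = Complex.exp ((Real.log (2 ^ m) : ℝ) : ℂ) := by
      rw [← Complex.ofReal_exp, Real.exp_log h2]
      push_cast
      rfl
    have h3 : d * (((2 ^ m * 2 ^ m : ℝ)) : ℂ) ≠ 0 :=
      mul_ne_zero hd (Complex.ofReal_ne_zero.2 (mul_pos h2 h2).ne')
    rw [e, Complex.cpow_def_of_ne_zero h3, Complex.cpow_def_of_ne_zero hd,
      Complex.log_mul_ofReal _ (mul_pos h2 h2) _ hd, Real.log_mul h2.ne' h2.ne', e',
      ← Complex.exp_add]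
    congr 1
    push_cast
    ring
  simp only [metaplecticFactor]
  rw [hdet, hsqrt, hE, hn, show ((n + n) + (m + m)) / 2 = n + m by omega,
    show (n + n) / 2 = n by omega, pow_add]
  field_simp

/-! ### The projector on a splitting -/

variable [MeasurableSpace F] [BorelSpace F] [MeasurableSpace L] [BorelSpace L]
    [MeasurableSpace E] [BorelSpace E]

/-- Both measures are translation invariant. The value of the constant is never needed:
`kernProj_map` eliminates it by comparing Gaussian masses. -/
theorem exists_map_volume : ∃ c : NNReal,
    ((volume : Measure F).prod (volume : Measure L)).map S.equiv = c • (volume : Measure E) := by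
  let e : (F × L) ≃L[ℝ] E := S.equiv.toContinuousLinearEquiv
  have : (((volume : Measure F).prod (volume : Measure L)).map e).IsAddHaarMeasure := e.isAddHaarMeasure_map _
  exact ⟨_, Measure.isAddLeftInvariant_eq_smul (((volume : Measure F).prod (volume : Measure L)).map e) volume⟩

theorem measurableEmbedding_equiv : MeasurableEmbedding S.equiv :=
  S.equiv.toContinuousLinearEquiv.toHomeomorph.measurableEmbedding

theorem integrable_comp {g : E → ℂ} (hg : Integrable g) :
    Integrable (fun p => g (S.equiv p)) ((volume : Measure F).prod (volume : Measure L)) := by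
  obtain ⟨c, hc⟩ := S.exists_map_volume
  have h : Integrable g (((volume : Measure F).prod (volume : Measure L)).map S.equiv) := by
    rw [hc]
    exact hg.smul_measure_nnreal
  exact (S.measurableEmbedding_equiv.integrable_map_iff).1 h

theorem exists_integral_comp : ∃ c : ℂ, ∀ g : E → ℂ,
    ∫ p, g (S.equiv p) ∂((volume : Measure F).prod (volume : Measure L)) = c * ∫ v, g v := by
  obtain ⟨c, hc⟩ := S.exists_map_volume
  refine ⟨((c : ℝ) : ℂ), fun g => ?_⟩
  have h := S.measurableEmbedding_equiv.integral_map (μ := ((volume : Measure F).prod (volume : Measure L))) g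
  rw [hc, integral_smul_nnreal_measure] at h
  rw [← h]
  rfl

/-- The projector acts on the first variable only, if the function belongs to the Bargmann space
with respect to the second one. -/
theorem kernProj_map {u : E → ℂ} (hu : MemLp u 2 (volume : Measure E))
    (hs : ∀ x, (fun l => u (S.equiv (x, l))) ∈ bargmann L) (x : F) (l : L) :
    kernProj u (S.equiv (x, l)) = kernProj (fun x' => u (S.equiv (x', l))) x := by
  obtain ⟨c, hc⟩ := S.exists_integral_comp
  have hgF : (gaussMass F : ℂ) ≠ 0 := by exact_mod_cast gaussMass_pos.ne'
  have hgL : (gaussMass L : ℂ) ≠ 0 := by exact_mod_cast gaussMass_pos.ne'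
  have hgE : (gaussMass E : ℂ) ≠ 0 := by exact_mod_cast gaussMass_pos.ne'
  have hmass : c * gaussMass E = gaussMass F * gaussMass L := by
    have h := hc fun v => ((Real.exp (-‖v‖ ^ 2) : ℝ) : ℂ)
    simp only [S.norm_sq_map, neg_add, Real.exp_add, Complex.ofReal_mul] at h
    rw [integral_prod_mul (fun x : F => ((Real.exp (-‖x‖ ^ 2) : ℝ) : ℂ))
      (fun l : L => ((Real.exp (-‖l‖ ^ 2) : ℝ) : ℂ))] at h
    simp only [integral_complex_ofReal] at h
    exact h.symm
  have hc0 : c ≠ 0 := by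
    rintro rfl
    rw [zero_mul] at hmass
    exact mul_ne_zero hgF hgL hmass.symm
  -- The kernel is a product, so Fubini's theorem isolates the integral over `L`, which the
  -- reproducing property evaluates at `l`.
  have hint : c * kernInt u (S.equiv (x, l)) = gaussMass L * (Real.exp (‖l‖ ^ 2 / 2) : ℝ) *
      kernInt (fun x' => u (S.equiv (x', l))) x := by
    have h1 : Integrable fun v => u v * kern (S.equiv (x, l)) v :=
      hu.integrable_mul (memLp_kern _)
    rw [kernInt, ← hc, integral_prod _ (S.integrable_comp h1), kernInt, ← integral_const_mul]
    refine integral_congr_ae (Filter.Eventually.of_forall fun x' => ?_)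
    have h2 := kernInt_of_mem (hs x') l
    simp only [kernInt] at h2
    simp only [S.kern_map, mul_left_comm (u _) (kern x x')]
    rw [integral_const_mul, h2]
    ring
  have hexp : ((Real.exp (-‖S.equiv (x, l)‖ ^ 2 / 2) : ℝ) : ℂ) * (Real.exp (‖l‖ ^ 2 / 2) : ℝ)
      = (Real.exp (-‖x‖ ^ 2 / 2) : ℝ) := by
    rw [← Complex.ofReal_mul, ← Real.exp_add, neg_div, S.norm_sq_map]
    congr 2
    ring
  rw [kernProj, kernProj, ← hexp]
  field_simp
  refine mul_left_cancel₀ hc0 ?_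
  linear_combination (gaussMass F : ℂ) * hint -
    kernInt (fun x' => u (S.equiv (x', l))) x * (Real.exp (‖l‖ ^ 2 / 2) : ℝ) * hmass

variable {ψ : E → ℂ}

theorem slice_fst_mem (hψ : ψ ∈ bargmann E) (hr : RapidDecay ψ) (l : L) :
    (fun x => ψ (S.equiv (x, l))) ∈ bargmann F := by
  have := slice_mem_bargmann hψ hr
    (LinearMap.toContinuousLinearMap (S.equiv.toLinearMap ∘ₗ LinearMap.inl ℝ F L))
    (fun x => by simp [S.J_map]) (S.equiv (0, l)) (fun x => by
      simp [S.map_add_map, S.norm_sq_map])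
  simpa [S.map_add_map] using this

theorem slice_snd_mem (hψ : ψ ∈ bargmann E) (hr : RapidDecay ψ) (x : F) :
    (fun l => ψ (S.equiv (x, l))) ∈ bargmann L := by
  have := slice_mem_bargmann hψ hr
    (LinearMap.toContinuousLinearMap (S.equiv.toLinearMap ∘ₗ LinearMap.inr ℝ F L))
    (fun x => by simp [S.J_map]) (S.equiv (x, 0)) (fun l => by
      simp [add_comm (S.equiv (0, _)), S.map_add_map, S.norm_sq_map, add_comm])
  simpa [add_comm (S.equiv (0, _)), S.map_add_map] using this

/-! ### Integration over a subspace of the second summand -/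

variable {K : Type*} [NormedAddCommGroup K] [InnerProductSpace ℝ K] [FiniteDimensional ℝ K]
  [MeasurableSpace K] [BorelSpace K] (j : K →ₗᵢ[ℝ] L)

/-- Integration over `K` in the second variable. -/
def fiberInt (u : E → ℂ) (x : F) : ℂ := ∫ y : K, u (S.equiv (x, j y))

theorem continuous_uncurry_fiber (hc : Continuous ψ) :
    Continuous fun p : F × K => ψ (S.equiv (p.1, j p.2)) := by
  have := S.continuous_equiv
  have := j.continuous
  fun_prop

theorem aestronglyMeasurable_fiberInt (hc : Continuous ψ) :
    AEStronglyMeasurable (S.fiberInt j ψ) volume :=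
  ((S.continuous_uncurry_fiber j hc).stronglyMeasurable.integral_prod_right').aestronglyMeasurable

theorem rapidDecay_fiberInt (hr : RapidDecay ψ) : RapidDecay (S.fiberInt j ψ) := by
  intro k
  obtain ⟨r, hK⟩ := RapidDecay.exists_integrable_bound (V := K)
  -- Of these powers, `r` pay for integrability in `y` and `k` for decay in `x`; both norms are at
  -- most that of the image point.
  obtain ⟨c, hc⟩ := hr (k + r)
  refine ⟨∫ y : K, c * ((1 + ‖y‖) ^ r)⁻¹, fun x => ?_⟩
  have h1 : (1 + ‖x‖) ^ k * ‖S.fiberInt j ψ x‖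
      = ‖∫ y : K, (((1 + ‖x‖) ^ k : ℝ) : ℂ) * ψ (S.equiv (x, j y))‖ := by
    rw [integral_const_mul, norm_mul, Complex.norm_real, Real.norm_of_nonneg (by positivity),
      fiberInt]
  rw [h1]
  refine norm_integral_le_of_norm_le (hK.const_mul c) (Filter.Eventually.of_forall fun y => ?_)
  rw [norm_mul, Complex.norm_real, Real.norm_of_nonneg (by positivity), ← div_eq_mul_inv,
    le_div_iff₀ (by positivity)]
  have h2 := S.norm_fst_le (x, j y)
  have h3 := S.norm_snd_le (x, j y)
  rw [j.norm_map] at h3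
  calc (1 + ‖x‖) ^ k * ‖ψ (S.equiv (x, j y))‖ * (1 + ‖y‖) ^ r
      ≤ (1 + ‖S.equiv (x, j y)‖) ^ k * ‖ψ (S.equiv (x, j y))‖ * (1 + ‖S.equiv (x, j y)‖) ^ r := by
        gcongr
    _ = (1 + ‖S.equiv (x, j y)‖) ^ (k + r) * ‖ψ (S.equiv (x, j y))‖ := by rw [pow_add]; ring
    _ ≤ c := hc _

/-- Fubini's theorem applies because the kernel is bounded by a Gaussian in `x'` while `ψ` decays in
`y` uniformly in `x'`. -/
theorem fiberInt_kernProj_slices (hc : Continuous ψ) (hr : RapidDecay ψ) (x : F) :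
    ∫ y : K, kernProj (fun x' => ψ (S.equiv (x', j y))) x = kernProj (S.fiberInt j ψ) x := by
  have hI : Integrable (Function.uncurry fun (x' : F) (y : K) =>
      ψ (S.equiv (x', j y)) * kern x x')
      ((volume : Measure F).prod (volume : Measure K)) := by
    obtain ⟨r, hK⟩ := RapidDecay.exists_integrable_bound (V := K)
    obtain ⟨c, hcr⟩ := hr r
    have hk : Integrable (kern x) := by
      refine ((integrable_gauss (E := F) (b := 1 / 4) (by norm_num)).const_mul
        (Real.exp (‖x‖ ^ 2))).mono' (continuous_kern x).aestronglyMeasurable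
        (Filter.Eventually.of_forall fun v => norm_kern_le x v)
    refine ((hk.norm.mul_prod (hK.const_mul c))).mono' ?_
      (Filter.Eventually.of_forall fun p => ?_)
    · exact ((S.continuous_uncurry_fiber j hc).mul
        ((continuous_kern x).comp continuous_fst)).aestronglyMeasurable
    · rw [Function.uncurry, norm_mul, mul_comm]
      gcongr
      rw [← div_eq_mul_inv, le_div_iff₀ (by positivity), mul_comm]
      refine le_trans ?_ (hcr (S.equiv (p.1, j p.2)))
      have h3 := S.norm_snd_le (p.1, j p.2)
      rw [j.norm_map] at h3
      gcongr
  simp only [kernProj]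
  rw [integral_mul_const, integral_const_mul]
  congr 2
  simp only [kernInt, fiberInt]
  rw [← integral_integral_swap hI]
  refine integral_congr_ae (Filter.Eventually.of_forall fun x' => ?_)
  simp only
  rw [integral_mul_const]

/-- Holomorphy needs no differentiation under the integral: every slice is fixed by `kernProj`,
hence so is the fibre integral, and a projected `L²` function lies in the Bargmann space. -/
theorem fiberInt_mem_smoothVectors (hψ : ψ ∈ smoothVectors E) :
    S.fiberInt j ψ ∈ smoothVectors F := by
  have hr := rapidDecay_of_smooth hψ
  have hc := bargmann_continuous hψ.1
  have hR := S.rapidDecay_fiberInt j hr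
  refine mem_smoothVectors_of_rapidDecay ?_ hR
  have h : S.fiberInt j ψ = kernProj (S.fiberInt j ψ) := by
    funext x
    rw [← S.fiberInt_kernProj_slices j hc hr x]
    simp only [kernProj_of_mem (S.slice_fst_mem hψ.1 hr _), fiberInt]
  rw [h]
  exact kernProj_mem_bargmann (hR.memLp_two (S.aestronglyMeasurable_fiberInt j hc))

/-- Integration over `K` intertwines the metaplectic operators. -/
theorem fiberInt_metaplectic (Φ : Sp E) (φ : Sp F)
    (h : ∀ p, (Φ : E ≃ₗ[ℝ] E) (S.equiv p) = S.equiv ((φ : F ≃ₗ[ℝ] F) p.1, p.2))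
    (ψ : bargmann E) (hψ : (ψ : E → ℂ) ∈ smoothVectors E)
    (hm : S.fiberInt j ψ ∈ bargmann F) :
    S.fiberInt j (metaplectic Φ ψ : E → ℂ)
      = (metaplectic φ ⟨S.fiberInt j ψ, hm⟩ : F → ℂ) := by
  have hr := rapidDecay_of_smooth hψ
  have hc := bargmann_continuous ψ.2
  have hsymm : ∀ x l, (Φ : E ≃ₗ[ℝ] E).symm (S.equiv (x, l))
      = S.equiv ((φ : F ≃ₗ[ℝ] F).symm x, l) := by
    intro x l
    rw [LinearEquiv.symm_apply_eq, h]
    simp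
  set u : E → ℂ := fun v => (ψ : E → ℂ) ((Φ : E ≃ₗ[ℝ] E).symm v) with hu
  have huc : Continuous u := continuous_comp_symm hc _
  have hur : RapidDecay u := hr.comp_symm _
  have hu2 : MemLp u 2 (volume : Measure E) := memLp_comp_symm _ ψ.2.2
  -- The change of variables leaves `l` alone, so holomorphy in the second variable survives it,
  -- although holomorphy in the first may not.
  have hs : ∀ x, (fun l => u (S.equiv (x, l))) ∈ bargmann L := fun x => by
    simp only [hu, hsymm]
    exact S.slice_snd_mem ψ.2 hr _
  funext x
  rw [metaplectic_apply, metaplectic_apply, S.metaplecticFactor_eq Φ φ h, Pi.smul_apply]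
  have h1 : S.fiberInt j (metaplecticFactor φ • kernProj u) x
      = metaplecticFactor φ • S.fiberInt j (kernProj u) x := integral_const_mul _ _
  rw [h1]
  congr 1
  rw [fiberInt]
  simp only [S.kernProj_map hu2 hs]
  rw [S.fiberInt_kernProj_slices j huc hur]
  congr 1
  funext x'
  simp only [fiberInt, hu, hsymm]

end KahlerSplitting

/-! ### The splitting defined by a coisotropic subspace -/

section Reduction

variable {E : Type*} [NormedAddCommGroup E] [InnerProductSpace ℝ E] [FiniteDimensional ℝ E]
  [KahlerSpace E] (C : Submodule ℝ E)

/-- On a `J`-invariant subspace the symplectic and the metric complement coincide. -/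
theorem sympAnn_maxComplex : sympAnn (maxComplex C) = (maxComplex C)ᗮ := by
  have h : (maxComplex C).map J = maxComplex C := by
    refine le_antisymm ?_ fun v hv => ⟨-J v, ?_, by simp [J_J]⟩
    · rintro _ ⟨v, hv, rfl⟩
      exact J_mem_maxComplex hv
    · exact (maxComplex C).neg_mem (J_mem_maxComplex hv)
  rw [sympAnn_eq, h]

theorem J_mem_sympAnn_maxComplex {v : E} (hv : v ∈ sympAnn (maxComplex C)) :
    J v ∈ sympAnn (maxComplex C) := by
  intro u hu
  have h := hv _ (J_mem_maxComplex hu)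
  change symp (J u) v = 0 at h
  change symp u (J v) = 0
  rw [← symp_J_J, J_J, map_neg, h, neg_zero]

/-- The Kähler structure of the orthogonal complement of the maximal complex subspace. -/
instance : KahlerSpace (sympAnn (maxComplex C)) where
  J := (J : E →ₗ[ℝ] E).restrict fun _ h => J_mem_sympAnn_maxComplex C h
  symp := (symp : LinearMap.BilinForm ℝ E).compl₁₂ (sympAnn (maxComplex C)).subtype
    (sympAnn (maxComplex C)).subtype
  J_J v := Subtype.ext (by simp [J_J])
  symp_self v := symp_self _
  inner_eq u v := by
    rw [Submodule.coe_inner, inner_eq]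
    simp

theorem sympAnn_le_sympAnn_maxComplex : sympAnn C ≤ sympAnn (maxComplex C) :=
  fun _ hv u hu => hv u hu.1

/-- The inclusion of `C°` into the orthogonal complement of the maximal complex subspace. -/
def annInclusion : sympAnn C →ₗᵢ[ℝ] sympAnn (maxComplex C) where
  toLinearMap := Submodule.inclusion (sympAnn_le_sympAnn_maxComplex C)
  norm_map' _ := rfl

variable [IsCoisotropic C]

/-- The orthogonal splitting of `E` into the reduction `F ≅ H` and `H°`. -/
def reductionSplitting : KahlerSplitting (Reduction C) (sympAnn (maxComplex C)) E where
  equiv := ((horizontal C).symm.prodCongr (LinearEquiv.refl ℝ _)) ≪≫ₗ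
    Submodule.prodEquivOfIsCompl _ _
      (sympAnn_maxComplex C ▸ Submodule.isCompl_orthogonal _)
  inner_map p q := by
    have h : ∀ (x : Reduction C) (l : sympAnn (maxComplex C)),
        inner ℝ ((horizontal C).symm x : E) (l : E) = 0 := fun x l =>
      Submodule.inner_right_of_mem_orthogonal ((horizontal C).symm x).2
        (sympAnn_maxComplex C ▸ l.2)
    have h' : inner ℝ p.1 q.1 =
        inner ℝ ((horizontal C).symm p.1 : E) ((horizontal C).symm q.1 : E) := rfl
    have h'' : inner ℝ p.2 q.2 = inner ℝ (p.2 : E) (q.2 : E) := rfl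
    simp [inner_add_left, inner_add_right, h, h', h'', real_inner_comm _ (p.2 : E)]
  J_map p := by
    have h : (((horizontal C).symm (J p.1) : maxComplex C) : E)
        = J ((horizontal C).symm p.1 : E) := by
      change (((horizontal C).symm (horizontal C _) : maxComplex C) : E) = _
      rw [LinearEquiv.symm_apply_apply]
      rfl
    have h' : ((J p.2 : sympAnn (maxComplex C)) : E) = J (p.2 : E) := rfl
    simp [h, h']

theorem reductionSplitting_apply (x : Reduction C) (l : sympAnn (maxComplex C)) :
    (reductionSplitting C).equiv (x, l) = ((horizontal C).symm x : E) + l := by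
  simp [reductionSplitting]

variable {C}

/-- For `l` in `H°` also `Jl` lies in `H°` and is fixed, so `g(Φv, l) = ω(Φv, ΦJl) = ω(v, Jl) = 0`;
thus `Φv` is orthogonal to `H°`. -/
theorem map_mem_maxComplex (Φ : Sp E) (hH : ∀ v ∈ sympAnn (maxComplex C), (Φ : E ≃ₗ[ℝ] E) v = v)
    {v : E} (hv : v ∈ maxComplex C) : (Φ : E ≃ₗ[ℝ] E) v ∈ maxComplex C := by
  rw [← Submodule.orthogonal_orthogonal (maxComplex C), ← sympAnn_maxComplex,
    Submodule.mem_orthogonal]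
  intro l hl
  have hl' := J_mem_sympAnn_maxComplex C hl
  have h := hl' v hv
  change symp v (J l) = 0 at h
  have e : (Φ : E ≃ₗ[ℝ] E) (J l) = J l := hH _ hl'
  rw [real_inner_comm, inner_eq, ← e, Φ.2, h]

/-- Since `Φ` preserves `H`, the horizontal representative of `φ([h])` is `Φ(h)` itself, with no
correction from `C°`. -/
theorem map_reductionSplitting (Φ : Sp E) (hC : C.map ((Φ : E ≃ₗ[ℝ] E) : E →ₗ[ℝ] E) = C)
    (hH : ∀ v ∈ sympAnn (maxComplex C), (Φ : E ≃ₗ[ℝ] E) v = v)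
    (p : Reduction C × sympAnn (maxComplex C)) :
    (Φ : E ≃ₗ[ℝ] E) ((reductionSplitting C).equiv p) = (reductionSplitting C).equiv
      ((reducedMap Φ hC : Reduction C ≃ₗ[ℝ] Reduction C) p.1, p.2) := by
  obtain ⟨x, l⟩ := p
  obtain ⟨h, rfl⟩ := (horizontal C).surjective x
  rw [reductionSplitting_apply, reductionSplitting_apply, map_add, hH _ l.2]
  have e : (reducedMap Φ hC : Reduction C ≃ₗ[ℝ] Reduction C) (horizontal C h)
      = horizontal C ⟨(Φ : E ≃ₗ[ℝ] E) h, map_mem_maxComplex Φ hH h.2⟩ := by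
    rw [horizontal_apply, reducedMap_proj, horizontal_apply]
  simp only [e, LinearEquiv.symm_apply_apply]

variable [MeasurableSpace E] [BorelSpace E]

/-- The integral over `C°` may be computed from the representative in `H`, and `C°` sits inside the
second summand `H°`. -/
theorem reduce_eq_fiberInt (ψ : E → ℂ) :
    reduce C ψ = (reductionSplitting C).fiberInt (annInclusion C) ψ := by
  funext x
  obtain ⟨h, rfl⟩ := (horizontal C).surjective x
  rw [horizontal_apply, reduce_proj, ← horizontal_apply]
  simp only [KahlerSplitting.fiberInt, reductionSplitting_apply, LinearEquiv.symm_apply_apply]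
  rfl

theorem integrable_add_sympAnn {ψ : E → ℂ} (hψ : ψ ∈ smoothVectors E) (v : E) :
    Integrable fun y : sympAnn C => ψ (v + (y : E)) := by
  have hc := bargmann_continuous hψ.1
  have hr : RapidDecay fun y : sympAnn C => ψ (v + (y : E)) :=
    -- The constant comes from `‖y‖ ≤ ‖v + y‖ + ‖v‖ ≤ (1 + ‖v‖)(1 + ‖v + y‖)`.
    (rapidDecay_of_smooth hψ).comp_of_norm_le (K := 1 + ‖v‖) (by positivity) fun y => by
      have h := norm_sub_le (v + (y : E)) v
      rw [add_sub_cancel_left] at h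
      rw [Submodule.coe_norm]
      nlinarith [norm_nonneg v, norm_nonneg (v + (y : E))]
  exact hr.integrable (by fun_prop : Continuous _).aestronglyMeasurable

end Reduction

end BargmannReduction
end
open BargmannReduction
theorem proposition4p5 {E : Type*} [NormedAddCommGroup E] [InnerProductSpace ℝ E]
    [FiniteDimensional ℝ E] [MeasurableSpace E] [BorelSpace E] [KahlerSpace E]
    (C : Submodule ℝ E) [IsCoisotropic C] (Φ : Sp E)
    (hC : C.map ((Φ : E ≃ₗ[ℝ] E) : E →ₗ[ℝ] E) = C)
    (hH : ∀ v ∈ sympAnn (maxComplex C), (Φ : E ≃ₗ[ℝ] E) v = v) :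
    -- `R` is a well-defined operator from `B^∞(E)` to `B^∞(F)`
    (∀ ψ ∈ smoothVectors E,
      (∀ v : C, Integrable (fun y : sympAnn C => ψ ((v : E) + (y : E))) volume) ∧
        reduce C ψ ∈ smoothVectors (Reduction C)) ∧
    -- `W(Φ)` preserves `B^∞(E)`, and `R ∘ W(Φ) = W(φ) ∘ R` there
    (∀ ψ : bargmann E, (ψ : E → ℂ) ∈ smoothVectors E →
      (metaplectic Φ ψ : E → ℂ) ∈ smoothVectors E ∧
      ∃ h : reduce C ψ ∈ bargmann (Reduction C),
        reduce C (metaplectic Φ ψ) = metaplectic (reducedMap Φ hC) ⟨reduce C ψ, h⟩) := by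
  have hR : ∀ ψ ∈ smoothVectors E, reduce C ψ ∈ smoothVectors (Reduction C) := fun ψ hψ => by
    rw [reduce_eq_fiberInt]
    exact (reductionSplitting C).fiberInt_mem_smoothVectors _ hψ
  refine ⟨fun ψ hψ => ⟨fun v => integrable_add_sympAnn hψ v, hR ψ hψ⟩, fun ψ hψ =>
    ⟨metaplectic_mem_smoothVectors Φ ψ hψ, (hR ψ hψ).1, ?_⟩⟩
  simp only [reduce_eq_fiberInt]
  exact (reductionSplitting C).fiberInt_metaplectic _ Φ _ (map_reductionSplitting Φ hC hH) ψ hψ _
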